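/- Let $Q$ be the quiver with vertices $0,1$, arrows $a_1,a_2\colon 0\to 1$, $b_1,b_2\colon 1\to 0$, a loop $c$ at $0$ and a loop $d$ at $1$, and let $I$ be the relations $$a_2b_ia_1=a_1b_ia_2,\quad b_2a_ib_1=b_1a_ib_2,\quad da_i=a_ic,\quad cb_i=b_id\qquad(i=1,2).$$ For $\Theta=(\theta_0,\theta_1)\in\mathbb R^2$ and a finite-dimensional complex representation $V=(V_0,V_1)$ of $(Q,I)$ put $\Theta(V)=\theta_0\dim V_0+\theta_1\dim V_1$ and $\mu_\Theta(V)=\Theta(V)/(\dim V_0+\dim V_1)$; $V$ is $\Theta$-stable if $\mu_\Theta(V')<\mu_\Theta(V)$ for all subrepresentations $0\ne V'\subsetneq V$. Let $X_0=\mathcal O_{\mathbb P^1}(-1,-1,0)$ be the total space of $\mathcal O(-1)\oplus\mathcal O(-1)\oplus\mathcal O$ over $\mathbb P^1$, with homogeneous coordinates $s_1,s_2$ (degree $1$, on the base), $w_1,w_2$ (degree $-1$) and $t$ (degree $0$) on the fibres, and let $X_0^+\cong\mathcal O_{\mathbb P^1}(-1,-1,0)$ be its flop over $Y_0=\operatorname{Spec}\mathbb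 C[x,y,z,w,u]/(xy-zw)$, with homogeneous coordinates $s_i^+=w_i$, $w_i^+=s_i$, $t$. Let $\Phi_0=\mathbf R\mathrm{Hom}(\mathcal O_{X_0}\oplus\mathcal O_{X_0}(1),-)$ and $\Phi_0^+=\mathbf R\mathrm{Hom}(\mathcal O_{X_0^+}\oplus\mathcal O_{X_0^+}(-1),-)$, with values in complexes of representations of $(Q,I)$; here $V_0$ comes from $\mathcal O$ and $V_1$ from the other summand, $a_i$ is given by $w_i=s_i^+$, $b_i$ by $s_i=w_i^+$, and $c,d$ by $t$. For $a\in\mathbb C$ let $j_a\colon\mathbb P^1\hookrightarrow\mathcal O_{\mathbb P^1}(-1,-1,0)$ be the curve $\{w_1=w_2=0,\ t=a\}$ (and likewise in $X_0^+$). Let $V$ be a non-zero finite-dimensional representation of $(Q,I)$. 1. If $V$ is $\Theta$-stable for some $\Theta\in\mathbb R^2$, then $\dim V_0=\dim V_1=1$, or $a_1=a_2=0$, or $b_1=b_2=0$. 2. $V$ is $\Theta$-stable for some $\Theta\in\mathbb R^2$ if and only if $V$ is isomorphic to one of (i) $\Phi_0(j_{a*}\mathcal O_{\mathbb P^1}(m-1))$,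 $a\in\mathbb C$, $m\ge1$; (ii) $\Phi_0(j_{a*}\mathcal O_{\mathbb P^1}(-m-1)[1])$, $a\in\mathbb C$, $m\ge0$; (iii) $\Phi_0(\mathcal O_x)$, $x\in X_0$; (iv) $\Phi_0^+(j_{a*}\mathcal O_{\mathbb P^1}(-m-1)[1])$, $a\in\mathbb C$, $m\ge1$; (v) $\Phi_0^+(j_{a*}\mathcal O_{\mathbb P^1}(m-1))$, $a\in\mathbb C$, $m\ge0$; (vi) $\Phi_0^+(\mathcal O_x)$, $x\in X_0^+$. More precisely, if $\theta_0<\theta_1$ then $V$ is $\Theta$-stable if and only if it is of type (i), (ii) or (iii), and if $\theta_0>\theta_1$ then $V$ is $\Theta$-stable if and only if it is of type (iv), (v) or (vi). Each of the listed objects is (isomorphic to) a non-zero finite-dimensional representation, placed in degree $0$. 3. Put $$\begin{aligned} L^-_-(m)&=\{\theta_0<\theta_1,\ m\theta_0+(m-1)\theta_1=0\}\ (m\ge1),& L^+_-(m)&=\{\theta_0<\theta_1,\ m\theta_0+(m+1)\theta_1=0\}\ (m\ge0),\\ L^-_+(m)&=\{\theta_0>\theta_1,\ m\theta_0+(m-1)\theta_1=0\}\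 (m\ge1),& L^+_+(m)&=\{\theta_0>\theta_1,\ m\theta_0+(m+1)\theta_1=0\}\ (m\ge0),\\ L_-(\infty)&=\{\theta_0<\theta_1,\ \theta_0+\theta_1=0\},& L_+(\infty)&=\{\theta_0>\theta_1,\ \theta_0+\theta_1=0\}, \end{aligned}$$ and let $W(V)=\{\Theta: V\text{ is }\Theta\text{-stable and }\Theta(V)=0\}$. For $V$ of type (i) with parameter $m$, (ii) with parameter $m$, (iii), the part of $W(V)$ in the half-plane $\theta_0<\theta_1$ is $L^-_-(m)$, $L^+_-(m)$, $L_-(\infty)$ respectively; for $V$ of type (iv) with parameter $m$, (v) with parameter $m$, (vi), the part of $W(V)$ in the half-plane $\theta_0>\theta_1$ is $L^-_+(m)$, $L^+_+(m)$, $L_+(\infty)$ respectively. In each case this part is all of $W(V)$ if $m\ge2$ for (i), (iv), if $m\ge1$ for (ii), (v), and if $x$ lies on some curve $j_a(\mathbb P^1)$ for (iii), (vi). 4. Consider finite-dimensional framed representations $\widetilde V=(V_0,V_1,V_\infty=\mathbb C)$, that is, representations $(V_0,V_1)$ of $(Q,I)$ with a linear map $V_\infty\to V_0$. Such a $\widetilde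 V$ is $\Theta$-stable (semistable) if $\Theta(V_0',V_1')<0$ ($\le0$) for every non-zero subrepresentation $(V_0',V_1',0)$ and $\Theta(V_0',V_1')<\Theta(V_0,V_1)$ ($\le$) for every proper subrepresentation $(V_0',V_1',\mathbb C)$. The set of $\Theta\in\mathbb R^2\setminus\{(0,0)\}$ for which a strictly $\Theta$-semistable framed representation (semistable, not stable) exists is exactly $$\bigcup_{m\ge1}L^-_-(m)\ \cup\ \bigcup_{m\ge0}L^+_-(m)\ \cup\ L_-(\infty)\ \cup\ \bigcup_{m\ge1}L^-_+(m)\ \cup\ \bigcup_{m\ge0}L^+_+(m)\ \cup\ L_+(\infty).$$ -/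

import Mathlib

open scoped Polynomial LaurentPolynomial

universe u v

noncomputable section

namespace LocalConifold

/-! ### Representations of the quiver with relations -/

/-- A (possibly infinite dimensional) complex representation of the quiver with vertices `0`, `1`,
arrows `a₁, a₂ : 0 → 1`, `b₁, b₂ : 1 → 0`, loops `c` at `0` and `d` at `1`, and relations
`a₂ bᵢ a₁ = a₁ bᵢ a₂`, `b₂ aᵢ b₁ = b₁ aᵢ b₂`, `d aᵢ = aᵢ c`, `c bᵢ = bᵢ d`.
The indices `1, 2` are `0, 1 : Fin 2` here. -/
structure QuiverRep where
  V₀ : Type u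
  V₁ : Type u
  [grp₀ : AddCommGroup V₀]
  [grp₁ : AddCommGroup V₁]
  [mod₀ : Module ℂ V₀]
  [mod₁ : Module ℂ V₁]
  a : Fin 2 → V₀ →ₗ[ℂ] V₁
  b : Fin 2 → V₁ →ₗ[ℂ] V₀
  c : V₀ →ₗ[ℂ] V₀
  d : V₁ →ₗ[ℂ] V₁
  rel_aba : ∀ i x, a 1 (b i (a 0 x)) = a 0 (b i (a 1 x))
  rel_bab : ∀ i y, b 1 (a i (b 0 y)) = b 0 (a i (b 1 y))
  rel_da : ∀ i x, d (a i x) = a i (c x)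
  rel_cb : ∀ i y, c (b i y) = b i (d y)

attribute [instance] QuiverRep.grp₀ QuiverRep.grp₁ QuiverRep.mod₀ QuiverRep.mod₁

namespace QuiverRep

/-- Finite dimensionality of a representation. -/
def IsFinite (V : QuiverRep.{u}) : Prop := FiniteDimensional ℂ V.V₀ ∧ FiniteDimensional ℂ V.V₁

/-- The zero representation. -/
def IsZero (V : QuiverRep.{u}) : Prop := Subsingleton V.V₀ ∧ Subsingleton V.V₁

/-- A subrepresentation. -/
structure Sub (V : QuiverRep.{u}) where
  W₀ : Submodule ℂ V.V₀
  W₁ : Submodule ℂ V.V₁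
  a_mem : ∀ i, ∀ x ∈ W₀, V.a i x ∈ W₁
  b_mem : ∀ i, ∀ y ∈ W₁, V.b i y ∈ W₀
  c_mem : ∀ x ∈ W₀, V.c x ∈ W₀
  d_mem : ∀ y ∈ W₁, V.d y ∈ W₁

/-- `W = 0`. -/
def Sub.IsBot {V : QuiverRep.{u}} (W : V.Sub) : Prop := W.W₀ = ⊥ ∧ W.W₁ = ⊥

/-- `W = V`. -/
def Sub.IsTop {V : QuiverRep.{u}} (W : V.Sub) : Prop := W.W₀ = ⊤ ∧ W.W₁ = ⊤

/-- `Θ(V) = θ₀ dim V₀ + θ₁ dim V₁`. -/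
def theta (Θ : ℝ × ℝ) (V : QuiverRep.{u}) : ℝ :=
  Θ.1 * (Module.finrank ℂ V.V₀ : ℝ) + Θ.2 * (Module.finrank ℂ V.V₁ : ℝ)

/-- The slope `μ_Θ(V) = Θ(V) / (dim V₀ + dim V₁)`. -/
def slope (Θ : ℝ × ℝ) (V : QuiverRep.{u}) : ℝ :=
  V.theta Θ / ((Module.finrank ℂ V.V₀ : ℝ) + (Module.finrank ℂ V.V₁ : ℝ))

/-- `Θ(W)` for a subrepresentation. -/
def Sub.theta (Θ : ℝ × ℝ) {V : QuiverRep.{u}} (W : V.Sub) : ℝ :=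
  Θ.1 * (Module.finrank ℂ W.W₀ : ℝ) + Θ.2 * (Module.finrank ℂ W.W₁ : ℝ)

/-- `μ_Θ(W)` for a subrepresentation. -/
def Sub.slope (Θ : ℝ × ℝ) {V : QuiverRep.{u}} (W : V.Sub) : ℝ :=
  W.theta Θ / ((Module.finrank ℂ W.W₀ : ℝ) + (Module.finrank ℂ W.W₁ : ℝ))

/-- `Θ`-stability of a finite dimensional representation. -/
def IsStable (Θ : ℝ × ℝ) (V : QuiverRep.{u}) : Prop :=
  ∀ W : V.Sub, ¬ W.IsBot → ¬ W.IsTop → W.slope Θ < V.slope Θ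

/-- The wall of `V`: all `Θ` with `Θ(V) = 0` for which `V` is `Θ`-stable. -/
def wall (V : QuiverRep.{u}) : Set (ℝ × ℝ) := {Θ | V.IsStable Θ ∧ V.theta Θ = 0}

/-- Morphisms of representations. -/
structure Hom (V : QuiverRep.{u}) (V' : QuiverRep.{v}) where
  f₀ : V.V₀ →ₗ[ℂ] V'.V₀
  f₁ : V.V₁ →ₗ[ℂ] V'.V₁
  comm_a : ∀ i x, f₁ (V.a i x) = V'.a i (f₀ x)
  comm_b : ∀ i y, f₀ (V.b i y) = V'.b i (f₁ y)
  comm_c : ∀ x, f₀ (V.c x) = V'.c (f₀ x)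
  comm_d : ∀ y, f₁ (V.d y) = V'.d (f₁ y)

/-- `V ≅ V'`: there is a bijective morphism. -/
def Isomorphic (V : QuiverRep.{u}) (V' : QuiverRep.{v}) : Prop :=
  ∃ φ : V.Hom V', Function.Bijective φ.f₀ ∧ Function.Bijective φ.f₁

/-- The kernel of a morphism of representations. -/
def Hom.ker {V V' : QuiverRep.{u}} (φ : V.Hom V') : QuiverRep.{u} where
  V₀ := LinearMap.ker φ.f₀
  V₁ := LinearMap.ker φ.f₁
  a i := (V.a i).restrict fun x hx => by
    rw [LinearMap.mem_ker] at hx ⊢; rw [φ.comm_a, hx, map_zero]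
  b i := (V.b i).restrict fun x hx => by
    rw [LinearMap.mem_ker] at hx ⊢; rw [φ.comm_b, hx, map_zero]
  c := V.c.restrict fun x hx => by
    rw [LinearMap.mem_ker] at hx ⊢; rw [φ.comm_c, hx, map_zero]
  d := V.d.restrict fun x hx => by
    rw [LinearMap.mem_ker] at hx ⊢; rw [φ.comm_d, hx, map_zero]
  rel_aba i x := Subtype.ext (V.rel_aba i x)
  rel_bab i y := Subtype.ext (V.rel_bab i y)
  rel_da i x := Subtype.ext (V.rel_da i x)
  rel_cb i y := Subtype.ext (V.rel_cb i y)

/-- The cokernel of a morphism of representations. -/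
def Hom.coker {V V' : QuiverRep.{u}} (φ : V.Hom V') : QuiverRep.{u} where
  V₀ := V'.V₀ ⧸ LinearMap.range φ.f₀
  V₁ := V'.V₁ ⧸ LinearMap.range φ.f₁
  a i := Submodule.mapQ _ _ (V'.a i) (by rintro _ ⟨x, rfl⟩; exact ⟨_, φ.comm_a i x⟩)
  b i := Submodule.mapQ _ _ (V'.b i) (by rintro _ ⟨x, rfl⟩; exact ⟨_, φ.comm_b i x⟩)
  c := Submodule.mapQ _ _ V'.c (by rintro _ ⟨x, rfl⟩; exact ⟨_, φ.comm_c x⟩)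
  d := Submodule.mapQ _ _ V'.d (by rintro _ ⟨x, rfl⟩; exact ⟨_, φ.comm_d x⟩)
  rel_aba i x := by
    obtain ⟨x, rfl⟩ := Submodule.Quotient.mk_surjective _ x
    simp only [Submodule.mapQ_apply, V'.rel_aba]
  rel_bab i y := by
    obtain ⟨y, rfl⟩ := Submodule.Quotient.mk_surjective _ y
    simp only [Submodule.mapQ_apply, V'.rel_bab]
  rel_da i x := by
    obtain ⟨x, rfl⟩ := Submodule.Quotient.mk_surjective _ x
    simp only [Submodule.mapQ_apply, V'.rel_da]
  rel_cb i y := by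
    obtain ⟨y, rfl⟩ := Submodule.Quotient.mk_surjective _ y
    simp only [Submodule.mapQ_apply, V'.rel_cb]

end QuiverRep

/-- A representation `(V₀, V₁, V_∞ = ℂ)` of the framed quiver, which has one more vertex `∞` and
one more arrow `∞ → 0`. -/
structure FramedRep extends QuiverRep.{u} where
  framing : ℂ →ₗ[ℂ] V₀

namespace FramedRep

/-- `Θ`-semistability. As `V_∞ = ℂ`, a subrepresentation has `V_∞' = 0`, and then it is just a
subrepresentation `W` of `(V₀, V₁)`, or `V_∞' = ℂ`, and then `W` contains the image of `V_∞`. -/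
def IsSemistable (Θ : ℝ × ℝ) (V : FramedRep.{u}) : Prop :=
  (∀ W : V.toQuiverRep.Sub, ¬ W.IsBot → W.theta Θ ≤ 0) ∧
  (∀ W : V.toQuiverRep.Sub, LinearMap.range V.framing ≤ W.W₀ → ¬ W.IsTop →
    W.theta Θ ≤ V.toQuiverRep.theta Θ)

/-- `Θ`-stability of framed representations. -/
def IsStable (Θ : ℝ × ℝ) (V : FramedRep.{u}) : Prop :=
  (∀ W : V.toQuiverRep.Sub, ¬ W.IsBot → W.theta Θ < 0) ∧
  (∀ W : V.toQuiverRep.Sub, LinearMap.range V.framing ≤ W.W₀ → ¬ W.IsTop →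
    W.theta Θ < V.toQuiverRep.theta Θ)

/-- The set of `Θ` that lie on a wall for framed stability: some finite dimensional representation
with `V_∞ = ℂ` is strictly `Θ`-semistable. -/
def walls : Set (ℝ × ℝ) :=
  {Θ | ∃ V : FramedRep.{u}, V.toQuiverRep.IsFinite ∧ V.IsSemistable Θ ∧ ¬ V.IsStable Θ}

end FramedRep

/-! ### The variety `X = 𝒪(-1,-1,0)` over `ℙ¹` and its quasi-coherent sheaves

`X` is the total space of `𝒪(-1) ⊕ 𝒪(-1) ⊕ 𝒪`. In terms of homogeneous coordinates `s₀, s₁` of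
degree `1` (on the base), `w₀, w₁` of degree `-1` and `t` of degree `0` (on the fibres) it is
covered by two charts isomorphic to `𝔸⁴`:
`U₀ = {s₀ ≠ 0}` with coordinates `(z, u₀, u₁, t) = (s₁/s₀, s₀ w₀, s₀ w₁, t)`, and
`U₁ = {s₁ ≠ 0}` with coordinates `(z', u₀', u₁', t) = (s₀/s₁, s₁ w₀, s₁ w₁, t)`.
On the overlap `z' = z⁻¹` and `uᵢ' = z uᵢ`. -/

/-- The coordinate ring of either chart. `X 0` is the coordinate along `ℙ¹`, and `X 1`, `X 2`, `X 3`
are the coordinates on the fibres of `𝒪(-1)`, `𝒪(-1)`, `𝒪`. -/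
abbrev Chart : Type := MvPolynomial (Fin 4) ℂ

/-- The coordinate ring of the overlap `{z ≠ 0} ⊆ U₀`. -/
abbrev Overlap : Type := Localization.Away (MvPolynomial.X 0 : Chart)

/-- Restriction of functions from `U₀` to the overlap. -/
def fromU₀ : Chart →ₐ[ℂ] Overlap := IsScalarTower.toAlgHom ℂ Chart Overlap

/-- The function `z = s₁/s₀`, invertible on the overlap. -/
def z : Overlapˣ :=
  (IsLocalization.Away.algebraMap_isUnit (S := Overlap) (MvPolynomial.X 0 : Chart)).unit

/-- Restriction of functions from `U₁` to the overlap. -/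
def fromU₁ : Chart →ₐ[ℂ] Overlap :=
  MvPolynomial.aeval ![((z⁻¹ : Overlapˣ) : Overlap), z * fromU₀ (MvPolynomial.X 1),
    z * fromU₀ (MvPolynomial.X 2), fromU₀ (MvPolynomial.X 3)]

/-- A quasi-coherent sheaf on `X`: a module on each of the two charts and on the overlap, where the
module on the overlap is the localization of those on the charts (surjectivity up to powers of the
inverted coordinate, and the kernel is the torsion by such powers). -/
structure QCoh where
  M₀ : Type
  M₁ : Type
  M₀₁ : Type
  [grp₀ : AddCommGroup M₀]
  [grp₁ : AddCommGroup M₁]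
  [grp₀₁ : AddCommGroup M₀₁]
  [cmod₀ : Module ℂ M₀]
  [cmod₁ : Module ℂ M₁]
  [cmod₀₁ : Module ℂ M₀₁]
  [mod₀ : Module Chart M₀]
  [mod₁ : Module Chart M₁]
  [mod₀₁ : Module Overlap M₀₁]
  [tower₀ : IsScalarTower ℂ Chart M₀]
  [tower₁ : IsScalarTower ℂ Chart M₁]
  [tower₀₁ : IsScalarTower ℂ Overlap M₀₁]
  res₀ : M₀ →ₗ[ℂ] M₀₁
  res₁ : M₁ →ₗ[ℂ] M₀₁
  res₀_smul : ∀ (f : Chart) (m : M₀), res₀ (f • m) = fromU₀ f • res₀ m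
  res₁_smul : ∀ (f : Chart) (m : M₁), res₁ (f • m) = fromU₁ f • res₁ m
  surj₀ : ∀ n : M₀₁, ∃ (k : ℕ) (m : M₀), fromU₀ (MvPolynomial.X 0 ^ k) • n = res₀ m
  surj₁ : ∀ n : M₀₁, ∃ (k : ℕ) (m : M₁), fromU₁ (MvPolynomial.X 0 ^ k) • n = res₁ m
  ker₀ : ∀ m : M₀, res₀ m = 0 → ∃ k : ℕ, (MvPolynomial.X 0 ^ k : Chart) • m = 0
  ker₁ : ∀ m : M₁, res₁ m = 0 → ∃ k : ℕ, (MvPolynomial.X 0 ^ k : Chart) • m = 0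

attribute [instance] QCoh.grp₀ QCoh.grp₁ QCoh.grp₀₁ QCoh.cmod₀ QCoh.cmod₁ QCoh.cmod₀₁
  QCoh.mod₀ QCoh.mod₁ QCoh.mod₀₁ QCoh.tower₀ QCoh.tower₁ QCoh.tower₀₁

/-- A global section of the line bundle `𝒪_X(k)`, the pull-back of `𝒪(k)` from `ℙ¹`, in the
trivializations `s₀ᵏ` on `U₀` and `s₁ᵏ` on `U₁`; so `s₁ᵏ = zᵏ s₀ᵏ` on the overlap. -/
structure LineSection (k : ℤ) where
  f₀ : Chart
  f₁ : Chart
  compat : fromU₀ f₀ = ((z ^ k : Overlapˣ) : Overlap) * fromU₁ f₁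

theorem fromU₀_X0 : fromU₀ (MvPolynomial.X 0) = (z : Overlap) := rfl

/-- The homogeneous coordinates `s₀, s₁`, as sections of `𝒪_X(1)`. -/
def sSec : Fin 2 → LineSection 1 :=
  ![⟨1, MvPolynomial.X 0, by simp [fromU₁]⟩, ⟨MvPolynomial.X 0, 1, by simp [fromU₀_X0]⟩]

/-- The tautological fibre coordinates `w₀, w₁`, as sections of `𝒪_X(-1)`. -/
def wSec : Fin 2 → LineSection (-1) :=
  ![⟨MvPolynomial.X 1, MvPolynomial.X 1, by simp [fromU₁]⟩,
    ⟨MvPolynomial.X 2, MvPolynomial.X 2, by simp [fromU₁]⟩]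

/-- The fibre coordinate `t`, a function on `X`. -/
def tSec : LineSection 0 := ⟨MvPolynomial.X 3, MvPolynomial.X 3, by simp [fromU₁]⟩

namespace QCoh

variable (F : QCoh)

/-- The twist `F(k) = F ⊗ 𝒪_X(k)`, in the trivializations above: the modules on the charts
and on the overlap stay the same, and one of the restriction maps is multiplied by `zᵏ`. -/
def twist (k : ℤ) : QCoh where
  M₀ := F.M₀
  M₁ := F.M₁
  M₀₁ := F.M₀₁
  res₀ := F.res₀
  res₁ := (Algebra.lsmul ℂ ℂ F.M₀₁ ((z ^ k : Overlapˣ) : Overlap)).comp F.res₁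
  res₀_smul := F.res₀_smul
  res₁_smul f m := by
    simp only [LinearMap.comp_apply, Algebra.lsmul_coe, F.res₁_smul, smul_smul, mul_comm]
  surj₀ := F.surj₀
  surj₁ n := by
    obtain ⟨j, m, h⟩ := F.surj₁ (((z ^ (-k) : Overlapˣ) : Overlap) • n)
    refine ⟨j, m, ?_⟩
    change _ = ((z ^ k : Overlapˣ) : Overlap) • F.res₁ m
    rw [← h, smul_smul, smul_smul, mul_right_comm, ← Units.val_mul, ← zpow_add]
    simp
  ker₀ := F.ker₀
  ker₁ m h := by
    refine F.ker₁ m ?_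
    rw [LinearMap.comp_apply, Algebra.lsmul_coe] at h
    have := congrArg (fun n => ((z ^ (-k) : Overlapˣ) : Overlap) • n) h
    simpa [smul_smul, ← Units.val_mul, ← zpow_add] using this

/-- The Čech differential `F(U₀) × F(U₁) → F(U₀ ∩ U₁)`. As `X` is separated and the `Uᵢ` are
affine, its kernel and cokernel are `H⁰(X, F)` and `H¹(X, F)`, and `Hⁱ(X, F) = 0` for `i > 1`. -/
def cech : (F.M₀ × F.M₁) →ₗ[ℂ] F.M₀₁ :=
  F.res₀.comp (LinearMap.fst ℂ F.M₀ F.M₁) - F.res₁.comp (LinearMap.snd ℂ F.M₀ F.M₁)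

/-- Multiplication by a section of `𝒪_X(k)` on Čech `0`-cochains of `F(n)`, for any `n`. -/
def mul₀ {k : ℤ} (σ : LineSection k) : (F.M₀ × F.M₁) →ₗ[ℂ] (F.M₀ × F.M₁) :=
  LinearMap.prodMap (Algebra.lsmul ℂ ℂ F.M₀ σ.f₀) (Algebra.lsmul ℂ ℂ F.M₁ σ.f₁)

/-- Multiplication by a section of `𝒪_X(k)` on Čech `1`-cochains of `F(n)`, for any `n`
(in the trivialization over `U₀`). -/
def mul₁ {k : ℤ} (σ : LineSection k) : F.M₀₁ →ₗ[ℂ] F.M₀₁ :=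
  Algebra.lsmul ℂ ℂ F.M₀₁ (fromU₀ σ.f₀)

theorem cech_mul {k n n' : ℤ} (h : n + k = n') (σ : LineSection k) (m : F.M₀ × F.M₁) :
    (F.twist n').cech (F.mul₀ σ m) = F.mul₁ σ ((F.twist n).cech m) := by
  subst h
  obtain ⟨m₀, m₁⟩ := m
  change F.res₀ (σ.f₀ • m₀) - ((z ^ (n + k) : Overlapˣ) : Overlap) • F.res₁ (σ.f₁ • m₁) =
    fromU₀ σ.f₀ • (F.res₀ m₀ - ((z ^ n : Overlapˣ) : Overlap) • F.res₁ m₁)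
  rw [F.res₀_smul, F.res₁_smul, smul_sub, smul_smul, smul_smul, σ.compat, zpow_add,
    Units.val_mul]
  congr 2
  ring

variable {k l : ℤ} (α : Fin 2 → LineSection k) (β : Fin 2 → LineSection l)

/-- Čech `0`-cochains of `F` (at vertex `0`) and of a twist of `F` (at vertex `1`); the arrows
`aᵢ`, `bᵢ` act by multiplication by `αᵢ`, `βᵢ`, and the loops by multiplication by `t`. -/
def cochain₀ : QuiverRep.{0} where
  V₀ := F.M₀ × F.M₁
  V₁ := F.M₀ × F.M₁
  a i := F.mul₀ (α i)
  b i := F.mul₀ (β i)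
  c := F.mul₀ tSec
  d := F.mul₀ tSec
  rel_aba i x := by
    ext <;> simp only [mul₀, LinearMap.prodMap_apply, Algebra.lsmul_coe, smul_smul] <;>
      congr 1 <;> ring
  rel_bab i x := by
    ext <;> simp only [mul₀, LinearMap.prodMap_apply, Algebra.lsmul_coe, smul_smul] <;>
      congr 1 <;> ring
  rel_da i x := by
    ext <;> simp only [mul₀, LinearMap.prodMap_apply, Algebra.lsmul_coe, smul_smul] <;>
      congr 1 <;> ring
  rel_cb i x := by
    ext <;> simp only [mul₀, LinearMap.prodMap_apply, Algebra.lsmul_coe, smul_smul] <;>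
      congr 1 <;> ring

/-- Čech `1`-cochains of `F` (at vertex `0`) and of a twist of `F` (at vertex `1`). -/
def cochain₁ : QuiverRep.{0} where
  V₀ := F.M₀₁
  V₁ := F.M₀₁
  a i := F.mul₁ (α i)
  b i := F.mul₁ (β i)
  c := F.mul₁ tSec
  d := F.mul₁ tSec
  rel_aba i x := by simp only [mul₁, Algebra.lsmul_coe, smul_smul]; congr 1; ring
  rel_bab i x := by simp only [mul₁, Algebra.lsmul_coe, smul_smul]; congr 1; ring
  rel_da i x := by simp only [mul₁, Algebra.lsmul_coe, smul_smul]; congr 1; ring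
  rel_cb i x := by simp only [mul₁, Algebra.lsmul_coe, smul_smul]; congr 1; ring

/-- The complex of representations `RHom(𝒪_X ⊕ 𝒪_X(-k), F)`, in degrees `0` and `1`, as the Čech
complex of `F` at vertex `0` and of `F(k)` at vertex `1`. The quiver acts through
`aᵢ = αᵢ ∈ Hom(𝒪_X(-k), 𝒪_X)`, `bᵢ = βᵢ ∈ Hom(𝒪_X, 𝒪_X(-k))` and through multiplication by `t`. -/
def rhom (h : k + l = 0) : (F.cochain₀ α β).Hom (F.cochain₁ α β) where
  f₀ := (F.twist 0).cech
  f₁ := (F.twist k).cech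
  comm_a i x := F.cech_mul (zero_add k) (α i) x
  comm_b i x := F.cech_mul h (β i) x
  comm_c x := F.cech_mul (add_zero 0) tSec x
  comm_d x := F.cech_mul (add_zero k) tSec x

/-- `Φ₀(F) = RHom(𝒪 ⊕ 𝒪(1), F)` on `X₀ = X`. The generators of `End(𝒪 ⊕ 𝒪(1))` are
`aᵢ = wᵢ : 𝒪(1) → 𝒪`, `bᵢ = sᵢ : 𝒪 → 𝒪(1)` and `t`. -/
def Φ₀ : (F.cochain₀ wSec sSec).Hom (F.cochain₁ wSec sSec) :=
  F.rhom wSec sSec (by norm_num)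

/-- `Φ₀⁺(F) = RHom(𝒪 ⊕ 𝒪(-1), F)` on the flop `X₀⁺`, which is also isomorphic to `X`. In homogeneous
coordinates the flop `X₀ ⇢ X₀⁺` over `Y₀` exchanges the coordinates on the base and those on the
fibres, `sᵢ⁺ = wᵢ` and `wᵢ⁺ = sᵢ`. So the strict transforms of `𝒪(1)`, `wᵢ`, `sᵢ` are
`𝒪(-1)`, `sᵢ⁺`, `wᵢ⁺`, and the generators of the algebra act as `aᵢ = sᵢ⁺ : 𝒪(-1) → 𝒪`,
`bᵢ = wᵢ⁺ : 𝒪 → 𝒪(-1)` and `t`. -/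
def Φ₀plus : (F.cochain₀ sSec wSec).Hom (F.cochain₁ sSec wSec) :=
  F.rhom sSec wSec (by norm_num)

end QCoh

/-- A two-term complex of representations `φ : C⁰ → C¹` in degrees `0`, `1` is isomorphic to `V`
(in degree `0`) in the derived category, that is, `H⁰ ≅ V` and `H¹ = 0`. -/
def Represents {C₀ C₁ : QuiverRep.{u}} (φ : C₀.Hom C₁) (V : QuiverRep.{v}) : Prop :=
  φ.ker.Isomorphic V ∧ φ.coker.IsZero

/-- The shift by `[1]` of a two-term complex of representations `φ : C⁰ → C¹` in degrees `0`, `1`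
is isomorphic to `V` (in degree `0`) in the derived category, that is, `H¹ ≅ V` and `H⁰ = 0`. -/
def ShiftRepresents {C₀ C₁ : QuiverRep.{u}} (φ : C₀.Hom C₁) (V : QuiverRep.{v}) : Prop :=
  φ.coker.Isomorphic V ∧ φ.ker.IsZero

/-! ### Sheaves supported on fibres and at points -/

/-- A scheme `Z` with an affine morphism to `X`: the coordinate rings of the preimages of `U₀`, `U₁`
and of the overlap, with the pull-back maps of functions. -/
structure AffineOver where
  B₀ : Type
  B₁ : Type
  B₀₁ : Type
  [ring₀ : CommRing B₀]
  [ring₁ : CommRing B₁]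
  [ring₀₁ : CommRing B₀₁]
  [alg₀ : Algebra ℂ B₀]
  [alg₁ : Algebra ℂ B₁]
  [alg₀₁ : Algebra ℂ B₀₁]
  pull₀ : Chart →ₐ[ℂ] B₀
  pull₁ : Chart →ₐ[ℂ] B₁
  pull₀₁ : Overlap →ₐ[ℂ] B₀₁
  r₀ : B₀ →ₐ[ℂ] B₀₁
  r₁ : B₁ →ₐ[ℂ] B₀₁
  r₀_pull : r₀.comp pull₀ = pull₀₁.comp fromU₀
  r₁_pull : r₁.comp pull₁ = pull₀₁.comp fromU₁
  surj₀ : ∀ n : B₀₁, ∃ (k : ℕ) (m : B₀), r₀ (pull₀ (MvPolynomial.X 0)) ^ k * n = r₀ m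
  surj₁ : ∀ n : B₀₁, ∃ (k : ℕ) (m : B₁), r₁ (pull₁ (MvPolynomial.X 0)) ^ k * n = r₁ m
  ker₀ : ∀ m : B₀, r₀ m = 0 → ∃ k : ℕ, pull₀ (MvPolynomial.X 0) ^ k * m = 0
  ker₁ : ∀ m : B₁, r₁ m = 0 → ∃ k : ℕ, pull₁ (MvPolynomial.X 0) ^ k * m = 0

attribute [instance] AffineOver.ring₀ AffineOver.ring₁ AffineOver.ring₀₁ AffineOver.alg₀
  AffineOver.alg₁ AffineOver.alg₀₁

/-- The direct image on `X` of the line bundle on `Z` with transition function `g`: its sections are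
pairs `f₀`, `f₁` of functions over the two charts with `f₀ = g f₁` on the overlap. -/
def AffineOver.pushforward (Z : AffineOver) (g : Z.B₀₁ˣ) : QCoh :=
  letI : Module Chart Z.B₀ := Module.compHom Z.B₀ Z.pull₀.toRingHom
  letI : Module Chart Z.B₁ := Module.compHom Z.B₁ Z.pull₁.toRingHom
  letI : Module Overlap Z.B₀₁ := Module.compHom Z.B₀₁ Z.pull₀₁.toRingHom
  have sm₀ (f : Chart) (m : Z.B₀) : f • m = Z.pull₀ f * m := rfl
  have sm₁ (f : Chart) (m : Z.B₁) : f • m = Z.pull₁ f * m := rfl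
  have sm₀₁ (f : Overlap) (m : Z.B₀₁) : f • m = Z.pull₀₁ f * m := rfl
  have c₀ (f : Chart) : Z.r₀ (Z.pull₀ f) = Z.pull₀₁ (fromU₀ f) := DFunLike.congr_fun Z.r₀_pull f
  have c₁ (f : Chart) : Z.r₁ (Z.pull₁ f) = Z.pull₀₁ (fromU₁ f) := DFunLike.congr_fun Z.r₁_pull f
  { M₀ := Z.B₀
    M₁ := Z.B₁
    M₀₁ := Z.B₀₁
    tower₀ := ⟨fun x f m => by rw [sm₀, sm₀, map_smul, smul_mul_assoc]⟩
    tower₁ := ⟨fun x f m => by rw [sm₁, sm₁, map_smul, smul_mul_assoc]⟩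
    tower₀₁ := ⟨fun x f m => by rw [sm₀₁, sm₀₁, map_smul, smul_mul_assoc]⟩
    res₀ := Z.r₀.toLinearMap
    res₁ := (LinearMap.mulLeft ℂ (g : Z.B₀₁)).comp Z.r₁.toLinearMap
    res₀_smul := fun f m => by
      rw [sm₀, sm₀₁, ← c₀]; exact map_mul Z.r₀ _ _
    res₁_smul := fun f m => by
      rw [sm₁, sm₀₁, ← c₁]
      change (g : Z.B₀₁) * Z.r₁ (Z.pull₁ f * m) = Z.r₁ (Z.pull₁ f) * ((g : Z.B₀₁) * Z.r₁ m)
      rw [map_mul]; ring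
    surj₀ := fun n => by
      obtain ⟨k, m, h⟩ := Z.surj₀ n
      exact ⟨k, m, by rw [sm₀₁, ← c₀, map_pow, map_pow]; exact h⟩
    surj₁ := fun n => by
      obtain ⟨k, m, h⟩ := Z.surj₁ (((g⁻¹ : Z.B₀₁ˣ) : Z.B₀₁) * n)
      refine ⟨k, m, ?_⟩
      rw [sm₀₁, ← c₁, map_pow, map_pow]
      change _ = (g : Z.B₀₁) * Z.r₁ m
      rw [← h, mul_left_comm, Units.mul_inv_cancel_left]
    ker₀ := fun m h => by
      obtain ⟨k, h⟩ := Z.ker₀ m h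
      exact ⟨k, by rw [sm₀, map_pow]; exact h⟩
    ker₁ := fun m h => by
      obtain ⟨k, h⟩ := Z.ker₁ m ((Units.mul_right_eq_zero g).1 h)
      exact ⟨k, by rw [sm₁, map_pow]; exact h⟩ }

namespace P1

/-- Pull-back of functions from either chart of `X` to the chart `𝔸¹` of `ℙ¹`. -/
def pull (a : ℂ) : Chart →ₐ[ℂ] ℂ[X] :=
  MvPolynomial.aeval ![Polynomial.X, 0, 0, Polynomial.C a]

/-- Pull-back of functions from the overlap of the charts of `X` to that of the charts of `ℙ¹`. -/
def pullOverlap (a : ℂ) : Overlap →ₐ[ℂ] ℂ[T;T⁻¹] :=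
  IsLocalization.liftAlgHom (M := Submonoid.powers (MvPolynomial.X 0 : Chart))
    (f := Polynomial.toLaurentAlg.comp (pull a))
    (by
      rintro ⟨_, n, rfl⟩
      simpa [pull] using (LaurentPolynomial.isUnit_T (R := ℂ) 1).pow n)

theorem pullOverlap_fromU₀ (a : ℂ) (f : Chart) :
    pullOverlap a (fromU₀ f) = Polynomial.toLaurent (pull a f) :=
  IsLocalization.lift_eq _ f

theorem pullOverlap_z (a : ℂ) : pullOverlap a (z : Overlap) = LaurentPolynomial.T 1 := by
  rw [← fromU₀_X0, pullOverlap_fromU₀]; simp [pull]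

theorem pullOverlap_z_inv (a : ℂ) :
    pullOverlap a ((z⁻¹ : Overlapˣ) : Overlap) = LaurentPolynomial.T (-1) := by
  have h : pullOverlap a ((z⁻¹ : Overlapˣ) : Overlap) * LaurentPolynomial.T 1 = 1 := by
    rw [← pullOverlap_z a, ← map_mul, Units.inv_mul, map_one]
  calc _ = pullOverlap a ((z⁻¹ : Overlapˣ) : Overlap) *
        (LaurentPolynomial.T 1 * LaurentPolynomial.T (-1)) := by
        rw [← LaurentPolynomial.T_add, add_neg_cancel, LaurentPolynomial.T_zero, mul_one]
    _ = _ := by rw [← mul_assoc, h, one_mul]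

end P1

/-- `ℙ¹ = {z} ∪ {z' = z⁻¹}` with the closed immersion `j_a : ℙ¹ → X` onto the curve
`w₀ = w₁ = 0`, `t = a`. -/
def P1 (a : ℂ) : AffineOver where
  B₀ := ℂ[X]
  B₁ := ℂ[X]
  B₀₁ := ℂ[T;T⁻¹]
  pull₀ := P1.pull a
  pull₁ := P1.pull a
  pull₀₁ := P1.pullOverlap a
  r₀ := Polynomial.toLaurentAlg
  r₁ := (LaurentPolynomial.invert : ℂ[T;T⁻¹] ≃ₐ[ℂ] ℂ[T;T⁻¹]).toAlgHom.comp Polynomial.toLaurentAlg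
  r₀_pull := by
    ext1 i
    exact (P1.pullOverlap_fromU₀ a _).symm
  r₁_pull := by
    ext1 i
    change LaurentPolynomial.invert (Polynomial.toLaurent (P1.pull a (MvPolynomial.X i))) =
      P1.pullOverlap a (fromU₁ (MvPolynomial.X i))
    rw [fromU₁, P1.pull, MvPolynomial.aeval_X, MvPolynomial.aeval_X]
    fin_cases i
    · simp [P1.pullOverlap_z_inv]
    · simp [P1.pullOverlap_fromU₀, P1.pull]
    · simp [P1.pullOverlap_fromU₀, P1.pull]
    · simp [P1.pullOverlap_fromU₀, P1.pull]
  surj₀ n := by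
    obtain ⟨k, m, h⟩ := n.exists_T_pow
    exact ⟨k, m, by simp [P1.pull, h, mul_comm]⟩
  surj₁ n := by
    obtain ⟨k, m, h⟩ := (LaurentPolynomial.invert n).exists_T_pow
    refine ⟨k, m, ?_⟩
    change LaurentPolynomial.invert (Polynomial.toLaurent (P1.pull a (MvPolynomial.X 0))) ^ k * n =
      LaurentPolynomial.invert (Polynomial.toLaurent m)
    have hX : P1.pull a (MvPolynomial.X 0) = Polynomial.X := by simp [P1.pull]
    have hn : LaurentPolynomial.invert (LaurentPolynomial.invert n) = n :=
      LaurentPolynomial.invert.symm_apply_apply n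
    rw [h, hX, Polynomial.toLaurent_X, map_mul, hn, LaurentPolynomial.invert_T,
      LaurentPolynomial.invert_T, LaurentPolynomial.T_pow, mul_neg_one, mul_comm]
  ker₀ m h := ⟨0, by
    rw [pow_zero, one_mul]
    exact Polynomial.toLaurent_injective (h.trans (map_zero _).symm)⟩
  ker₁ m h := ⟨0, by
    rw [pow_zero, one_mul]
    refine Polynomial.toLaurent_injective (LaurentPolynomial.invert.injective ?_)
    exact h.trans (by rw [map_zero, map_zero])⟩

/-- The sheaf `j_{a*} 𝒪_{ℙ¹}(k)`, where `𝒪_{ℙ¹}(k)` has the transition function `zᵏ`. -/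
def lineSheaf (a : ℂ) (k : ℤ) : QCoh :=
  (P1 a).pushforward (LaurentPolynomial.isUnit_T (R := ℂ) k).unit

/-- Homogeneous coordinates of a (closed) point of `X`. -/
structure HPoint where
  s : Fin 2 → ℂ
  w : Fin 2 → ℂ
  t : ℂ
  s_ne : s ≠ 0

namespace HPoint

variable (x : HPoint)

/-- The values at `x` of the coordinates of the chart `Uᵢ = {sᵢ ≠ 0}` that contains `x`;
here `j` is the other index. -/
def eval (i j : Fin 2) : Chart →ₐ[ℂ] ℂ :=
  MvPolynomial.aeval ![x.s j / x.s i, x.s i * x.w 0, x.s i * x.w 1, x.t]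

/-- The value of a function on the overlap at a point of the overlap. -/
def evalOverlap (h : x.s 0 ≠ 0 ∧ x.s 1 ≠ 0) : Overlap →ₐ[ℂ] ℂ :=
  IsLocalization.liftAlgHom (M := Submonoid.powers (MvPolynomial.X 0 : Chart))
    (f := x.eval 0 1)
    (by
      rintro ⟨_, n, rfl⟩
      simp [eval, h.1, h.2])

theorem evalOverlap_fromU₀ (h : x.s 0 ≠ 0 ∧ x.s 1 ≠ 0) (f : Chart) :
    x.evalOverlap h (fromU₀ f) = x.eval 0 1 f :=
  IsLocalization.lift_eq _ f

theorem evalOverlap_z (h : x.s 0 ≠ 0 ∧ x.s 1 ≠ 0) :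
    x.evalOverlap h (z : Overlap) = x.s 1 / x.s 0 := by
  rw [← fromU₀_X0, evalOverlap_fromU₀]; simp [eval]

theorem evalOverlap_z_inv (h : x.s 0 ≠ 0 ∧ x.s 1 ≠ 0) :
    x.evalOverlap h ((z⁻¹ : Overlapˣ) : Overlap) = x.s 0 / x.s 1 := by
  have h1 : x.evalOverlap h ((z⁻¹ : Overlapˣ) : Overlap) * (x.s 1 / x.s 0) = 1 := by
    rw [← evalOverlap_z x h, ← map_mul, Units.inv_mul, map_one]
  obtain ⟨h0, h2⟩ := h
  field_simp at h1 ⊢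
  linear_combination h1

/-- The inclusion of the point `x` in `X`. The ring of functions on the part of `{x}` that lies in
an open set is `ℂ` or the zero ring, according as `x` lies in the open set or not. -/
def toAffineOver : AffineOver where
  B₀ := PLift (x.s 0 ≠ 0) → ℂ
  B₁ := PLift (x.s 1 ≠ 0) → ℂ
  B₀₁ := PLift (x.s 0 ≠ 0 ∧ x.s 1 ≠ 0) → ℂ
  pull₀ := AlgHom.pi fun _ => x.eval 0 1
  pull₁ := AlgHom.pi fun _ => x.eval 1 0
  pull₀₁ := AlgHom.pi fun h => x.evalOverlap h.down
  r₀ := AlgHom.pi fun h => Pi.evalAlgHom ℂ _ ⟨h.down.1⟩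
  r₁ := AlgHom.pi fun h => Pi.evalAlgHom ℂ _ ⟨h.down.2⟩
  r₀_pull := by
    ext1 i
    funext h
    exact (x.evalOverlap_fromU₀ h.down _).symm
  r₁_pull := by
    ext1 i
    funext ⟨h⟩
    have h0 := h.1
    have h1 := h.2
    change x.eval 1 0 (MvPolynomial.X i) = x.evalOverlap ⟨h0, h1⟩ (fromU₁ (MvPolynomial.X i))
    rw [fromU₁, eval, MvPolynomial.aeval_X, MvPolynomial.aeval_X]
    fin_cases i
    · exact (x.evalOverlap_z_inv _).symm
    · simp [evalOverlap_z, evalOverlap_fromU₀, eval]; field_simp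
    · simp [evalOverlap_z, evalOverlap_fromU₀, eval]; field_simp
    · simp [evalOverlap_fromU₀, eval]
  surj₀ n := by
    by_cases h : x.s 1 = 0
    · exact ⟨0, 0, funext fun h' => (h'.down.2 h).elim⟩
    · exact ⟨0, fun h' => n ⟨h'.down, h⟩, by funext h'; simp⟩
  surj₁ n := by
    by_cases h : x.s 0 = 0
    · exact ⟨0, 0, funext fun h' => (h'.down.1 h).elim⟩
    · exact ⟨0, fun h' => n ⟨h, h'.down⟩, by funext h'; simp⟩
  ker₀ m hm := by
    by_cases h : x.s 1 = 0
    · exact ⟨1, funext fun h' => by simp [eval, h]⟩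
    · exact ⟨0, funext fun h' => by simpa using congrFun hm ⟨h'.down, h⟩⟩
  ker₁ m hm := by
    by_cases h : x.s 0 = 0
    · exact ⟨1, funext fun h' => by simp [eval, h]⟩
    · exact ⟨0, funext fun h' => by simpa using congrFun hm ⟨h, h'.down⟩⟩

/-- The skyscraper sheaf `𝒪_x`. -/
def sheaf : QCoh := x.toAffineOver.pushforward 1

end HPoint

/-! ### The six types of representations and the six families of walls -/

namespace QuiverRep

variable (V : QuiverRep.{u})

/-- `V ≅ Φ₀(j_{a*} 𝒪(m-1))`. -/
def TypeI (a : ℂ) (m : ℕ) : Prop := Represents (lineSheaf a (m - 1)).Φ₀ V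

/-- `V ≅ Φ₀(j_{a*} 𝒪(-m-1)[1])`. -/
def TypeII (a : ℂ) (m : ℕ) : Prop := ShiftRepresents (lineSheaf a (-m - 1)).Φ₀ V

/-- `V ≅ Φ₀(𝒪_x)`, where `x` is a point of `X₀`. -/
def TypeIII (x : HPoint) : Prop := Represents x.sheaf.Φ₀ V

/-- `V ≅ Φ₀⁺(j_{a*} 𝒪(-m-1)[1])`. -/
def TypeIV (a : ℂ) (m : ℕ) : Prop := ShiftRepresents (lineSheaf a (-m - 1)).Φ₀plus V

/-- `V ≅ Φ₀⁺(j_{a*} 𝒪(m-1))`. -/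
def TypeV (a : ℂ) (m : ℕ) : Prop := Represents (lineSheaf a (m - 1)).Φ₀plus V

/-- `V ≅ Φ₀⁺(𝒪_x)`, where `x` is a point of `X₀⁺`. -/
def TypeVI (x : HPoint) : Prop := Represents x.sheaf.Φ₀plus V

end QuiverRep

/-- `L⁻₋(m)`. -/
def wallMinusMinus (m : ℕ) : Set (ℝ × ℝ) :=
  {Θ | Θ.1 < Θ.2 ∧ (m : ℝ) * Θ.1 + ((m : ℝ) - 1) * Θ.2 = 0}

/-- `L⁺₋(m)` (upper sign `+`, lower sign `-`). -/
def wallPlusMinus (m : ℕ) : Set (ℝ × ℝ) :=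
  {Θ | Θ.1 < Θ.2 ∧ (m : ℝ) * Θ.1 + ((m : ℝ) + 1) * Θ.2 = 0}

/-- `L₋(∞)`. -/
def wallInfMinus : Set (ℝ × ℝ) := {Θ | Θ.1 < Θ.2 ∧ Θ.1 + Θ.2 = 0}

/-- `L⁻₊(m)` (upper sign `-`, lower sign `+`). -/
def wallMinusPlus (m : ℕ) : Set (ℝ × ℝ) :=
  {Θ | Θ.2 < Θ.1 ∧ (m : ℝ) * Θ.1 + ((m : ℝ) - 1) * Θ.2 = 0}

/-- `L⁺₊(m)`. -/
def wallPlusPlus (m : ℕ) : Set (ℝ × ℝ) :=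
  {Θ | Θ.2 < Θ.1 ∧ (m : ℝ) * Θ.1 + ((m : ℝ) + 1) * Θ.2 = 0}

/-- `L₊(∞)`. -/
def wallInfPlus : Set (ℝ × ℝ) := {Θ | Θ.2 < Θ.1 ∧ Θ.1 + Θ.2 = 0}

end LocalConifold

end

open LocalConifold

universe w

noncomputable section

namespace LocalConifold

/-! ### Exchange of the two vertices, and transport along isomorphisms. -/

namespace QuiverRep

/-! Exchanging the two vertices preserves the relations and reflects the parameter plane in the
diagonal, so it is enough to classify the stable representations for `θ₀ < θ₁`. There the slope
inequality does not depend on `Θ`: it compares ratios of dimensions (`NegStable`), and Schur's lemma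
makes every endomorphism of a stable representation a scalar.

The relations say exactly that the loops, and the cycles `bᵢ aⱼ` together with `aⱼ bᵢ`, are
endomorphisms. If some cycle is a non-zero scalar, then a vector and its image span a
subrepresentation of dimension `(1, 1)` in one of dimension `(n, n)`, which forces `n = 1`. If all
cycles vanish, the images of the `aᵢ` lie in the common kernel of the `bᵢ`, which would destabilize,
so `aᵢ = 0`. What remains is a stable representation of the Kronecker quiver on which the loops act
by one scalar.

For dimension `(x, y)` the Euler form of the Kronecker quiver on the diagonal is `(x - y)²`, a lower
bound for the dimension of the endomorphism ring, which is `1`; hence `|x - y| ≤ 1`. If `x = y`, an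
eigenvector of the pencil `b₁ - l b₀` gives `x = y = 1`. If `|x - y| = 1`, the Euler form is
positive, so two stable representations of this dimension with the same loop scalar have a non-zero
morphism between them and are isomorphic. So the stable representations are the `preprojective`,
`preinjective` and `point` models, once these are shown to be stable (`negStable_iff`).

The Čech complexes of `𝒪(k)` on the projective line and of skyscraper sheaves identify these models
with the values of `Φ₀`, and the models with the vertices exchanged with those of `Φ₀plus`. A wall
is then the line `Θ(V) = 0` given by the dimension vector. A strictly semistable framed
representation yields an unframed semistable one with `Θ = 0`, hence a stable one inside it;
conversely a stable one with `Θ(V) = 0`, framed by zero, is strictly semistable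
(`FramedRep.mem_walls_iff`). -/

/-- The representation with the two vertices exchanged. -/
def swap (V : QuiverRep.{u}) : QuiverRep.{u} where
  V₀ := V.V₁
  V₁ := V.V₀
  a := V.b
  b := V.a
  c := V.d
  d := V.c
  rel_aba := V.rel_bab
  rel_bab := V.rel_aba
  rel_da := V.rel_cb
  rel_cb := V.rel_da

/-- A subrepresentation with the two vertices exchanged. -/
def Sub.swap {V : QuiverRep.{u}} (W : V.Sub) : V.swap.Sub where
  W₀ := W.W₁
  W₁ := W.W₀
  a_mem := W.b_mem
  b_mem := W.a_mem
  c_mem := W.d_mem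
  d_mem := W.c_mem

theorem IsFinite.swap {V : QuiverRep.{u}} (h : V.IsFinite) : V.swap.IsFinite := ⟨h.2, h.1⟩

theorem isZero_swap {V : QuiverRep.{u}} : V.swap.IsZero ↔ V.IsZero := and_comm

theorem theta_swap (V : QuiverRep.{u}) (Θ : ℝ × ℝ) : V.swap.theta Θ.swap = V.theta Θ :=
  add_comm _ _

theorem slope_swap (V : QuiverRep.{u}) (Θ : ℝ × ℝ) : V.swap.slope Θ.swap = V.slope Θ := by
  rw [slope, theta_swap, add_comm]; rfl

theorem Sub.theta_swap {V : QuiverRep.{u}} (W : V.Sub) (Θ : ℝ × ℝ) :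
    W.swap.theta Θ.swap = W.theta Θ :=
  add_comm _ _

theorem Sub.slope_swap {V : QuiverRep.{u}} (W : V.Sub) (Θ : ℝ × ℝ) :
    W.swap.slope Θ.swap = W.slope Θ := by
  rw [Sub.slope, W.theta_swap, add_comm]; rfl

theorem IsStable.swap {V : QuiverRep.{u}} {Θ : ℝ × ℝ} (h : V.IsStable Θ) :
    V.swap.IsStable Θ.swap := by
  intro W hb ht
  rw [slope_swap]
  exact (Sub.slope_swap (V := V.swap) W Θ.swap).symm.trans_lt
    (h W.swap (fun h => hb h.symm) (fun h => ht h.symm))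

theorem isStable_swap {V : QuiverRep.{u}} {Θ : ℝ × ℝ} :
    V.swap.IsStable Θ.swap ↔ V.IsStable Θ :=
  ⟨fun h => h.swap, fun h => h.swap⟩

theorem wall_swap (V : QuiverRep.{u}) : V.swap.wall = Prod.swap ⁻¹' V.wall := by
  ext Θ
  change _ ∧ _ ↔ _ ∧ _
  rw [← isStable_swap (V := V), ← theta_swap V, Prod.swap_swap]

namespace Isomorphic

theorem symm {V : QuiverRep.{u}} {V' : QuiverRep.{v}} (h : V.Isomorphic V') :
    V'.Isomorphic V := by
  obtain ⟨φ, h₀, h₁⟩ := h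
  let e₀ := LinearEquiv.ofBijective φ.f₀ h₀
  let e₁ := LinearEquiv.ofBijective φ.f₁ h₁
  refine ⟨⟨e₀.symm.toLinearMap, e₁.symm.toLinearMap, fun i x => ?_, fun i x => ?_, fun x => ?_,
    fun x => ?_⟩, e₀.symm.bijective, e₁.symm.bijective⟩
  · refine e₁.symm_apply_eq.2 (Eq.trans ?_ (φ.comm_a i (e₀.symm x)).symm)
    exact congrArg _ (e₀.apply_symm_apply x).symm
  · refine e₀.symm_apply_eq.2 (Eq.trans ?_ (φ.comm_b i (e₁.symm x)).symm)
    exact congrArg _ (e₁.apply_symm_apply x).symm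
  · refine e₀.symm_apply_eq.2 (Eq.trans ?_ (φ.comm_c (e₀.symm x)).symm)
    exact congrArg _ (e₀.apply_symm_apply x).symm
  · refine e₁.symm_apply_eq.2 (Eq.trans ?_ (φ.comm_d (e₁.symm x)).symm)
    exact congrArg _ (e₁.apply_symm_apply x).symm

theorem trans {V : QuiverRep.{u}} {V' : QuiverRep.{v}} {V'' : QuiverRep.{w}}
    (h : V.Isomorphic V') (h' : V'.Isomorphic V'') : V.Isomorphic V'' := by
  obtain ⟨φ, h₀, h₁⟩ := h
  obtain ⟨ψ, h₀', h₁'⟩ := h'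
  exact ⟨⟨ψ.f₀.comp φ.f₀, ψ.f₁.comp φ.f₁, fun i x => by simp [φ.comm_a, ψ.comm_a],
    fun i x => by simp [φ.comm_b, ψ.comm_b], fun x => by simp [φ.comm_c, ψ.comm_c],
    fun x => by simp [φ.comm_d, ψ.comm_d]⟩, h₀'.comp h₀, h₁'.comp h₁⟩

theorem swap {V : QuiverRep.{u}} {V' : QuiverRep.{v}} (h : V.Isomorphic V') :
    V.swap.Isomorphic V'.swap := by
  obtain ⟨φ, h₀, h₁⟩ := h
  exact ⟨⟨φ.f₁, φ.f₀, φ.comm_b, φ.comm_a, φ.comm_d, φ.comm_c⟩, h₁, h₀⟩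

section Transport

variable {V : QuiverRep.{u}} {V' : QuiverRep.{v}} (h : V.Isomorphic V')
include h

theorem finrank₀ : Module.finrank ℂ V.V₀ = Module.finrank ℂ V'.V₀ := by
  obtain ⟨φ, h₀, h₁⟩ := h
  exact (LinearEquiv.ofBijective φ.f₀ h₀).finrank_eq

theorem finrank₁ : Module.finrank ℂ V.V₁ = Module.finrank ℂ V'.V₁ := by
  obtain ⟨φ, h₀, h₁⟩ := h
  exact (LinearEquiv.ofBijective φ.f₁ h₁).finrank_eq

theorem isFinite (hV : V.IsFinite) : V'.IsFinite := by
  obtain ⟨φ, h₀, h₁⟩ := h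
  obtain ⟨_, _⟩ := hV
  exact ⟨Module.Finite.of_surjective _ h₀.2, Module.Finite.of_surjective _ h₁.2⟩

theorem isZero (hV : V.IsZero) : V'.IsZero := by
  obtain ⟨φ, h₀, h₁⟩ := h
  obtain ⟨_, _⟩ := hV
  exact ⟨h₀.2.subsingleton, h₁.2.subsingleton⟩

theorem theta (Θ : ℝ × ℝ) : V.theta Θ = V'.theta Θ := by
  rw [QuiverRep.theta, QuiverRep.theta, h.finrank₀, h.finrank₁]

theorem isStable {Θ : ℝ × ℝ} (hV : V.IsStable Θ) : V'.IsStable Θ := by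
  intro W hb ht
  have hs : V.slope Θ = V'.slope Θ := by
    rw [QuiverRep.slope, QuiverRep.slope, h.theta, h.finrank₀, h.finrank₁]
  obtain ⟨φ, h₀, h₁⟩ := h
  let e₀ := LinearEquiv.ofBijective φ.f₀ h₀
  let e₁ := LinearEquiv.ofBijective φ.f₁ h₁
  let W' : V.Sub :=
    { W₀ := W.W₀.comap φ.f₀
      W₁ := W.W₁.comap φ.f₁
      a_mem := fun i x hx => by
        rw [Submodule.mem_comap] at *; rw [φ.comm_a]; exact W.a_mem i _ hx
      b_mem := fun i x hx => by
        rw [Submodule.mem_comap] at *; rw [φ.comm_b]; exact W.b_mem i _ hx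
      c_mem := fun x hx => by
        rw [Submodule.mem_comap] at *; rw [φ.comm_c]; exact W.c_mem _ hx
      d_mem := fun x hx => by
        rw [Submodule.mem_comap] at *; rw [φ.comm_d]; exact W.d_mem _ hx }
  have m₀ : W'.W₀.map φ.f₀ = W.W₀ := Submodule.map_comap_eq_of_surjective h₀.2 _
  have m₁ : W'.W₁.map φ.f₁ = W.W₁ := Submodule.map_comap_eq_of_surjective h₁.2 _
  have r₀ : Module.finrank ℂ W'.W₀ = Module.finrank ℂ W.W₀ := by
    rw [← m₀]; exact (LinearEquiv.finrank_map_eq e₀ _).symm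
  have r₁ : Module.finrank ℂ W'.W₁ = Module.finrank ℂ W.W₁ := by
    rw [← m₁]; exact (LinearEquiv.finrank_map_eq e₁ _).symm
  have := hV W' (fun h => hb ?_) (fun h => ht ?_)
  · rwa [hs, Sub.slope, Sub.theta, r₀, r₁] at this
  · exact ⟨by rw [← m₀, h.1, Submodule.map_bot], by rw [← m₁, h.2, Submodule.map_bot]⟩
  · refine ⟨by rw [← m₀, h.1, Submodule.map_top, LinearMap.range_eq_top.2 h₀.2], ?_⟩
    rw [← m₁, h.2, Submodule.map_top, LinearMap.range_eq_top.2 h₁.2]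

end Transport

theorem wall_eq {V : QuiverRep.{u}} {V' : QuiverRep.{v}} (h : V.Isomorphic V') :
    V.wall = V'.wall := by
  ext Θ
  change _ ∧ _ ↔ _ ∧ _
  rw [h.theta]
  exact and_congr_left' ⟨h.isStable, h.symm.isStable⟩

end Isomorphic

/-! ### Stability on one side of the diagonal, and Schur's lemma. -/

/-- Stability with respect to the parameters `θ₀ < θ₁`. -/
def NegStable (V : QuiverRep.{u}) : Prop :=
  ∀ W : V.Sub, ¬ W.IsBot → ¬ W.IsTop →
    Module.finrank ℂ W.W₁ * Module.finrank ℂ V.V₀ < Module.finrank ℂ V.V₁ * Module.finrank ℂ W.W₀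

theorem Sub.finrank_add_pos {V : QuiverRep.{u}} (hV : V.IsFinite) {W : V.Sub} (hb : ¬ W.IsBot) :
    0 < Module.finrank ℂ W.W₀ + Module.finrank ℂ W.W₁ := by
  obtain ⟨_, _⟩ := hV
  by_contra! h
  exact hb ⟨Submodule.finrank_eq_zero.1 (by omega), Submodule.finrank_eq_zero.1 (by omega)⟩

/-- After cross-multiplication the difference of the two sides is `(Θ.2 - Θ.1) * (s * p - q * r)`,
so `Θ` enters only through the sign of `Θ.2 - Θ.1`. -/
theorem slope_lt_iff {Θ : ℝ × ℝ} (hΘ : Θ.1 < Θ.2) {p q r s : ℝ} (h : 0 < p + q) (h' : 0 < r + s) :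
    (Θ.1 * p + Θ.2 * q) / (p + q) < (Θ.1 * r + Θ.2 * s) / (r + s) ↔ q * r < s * p := by
  rw [div_lt_div_iff₀ h h', ← sub_pos, ← sub_pos (b := q * r)]
  have : (Θ.1 * r + Θ.2 * s) * (p + q) - (Θ.1 * p + Θ.2 * q) * (r + s) =
    (Θ.2 - Θ.1) * (s * p - q * r) := by ring
  rw [this, mul_pos_iff_of_pos_left (sub_pos.2 hΘ)]

theorem isStable_iff_negStable {V : QuiverRep.{u}} (hV : V.IsFinite) {Θ : ℝ × ℝ}
    (hΘ : Θ.1 < Θ.2) : V.IsStable Θ ↔ V.NegStable := by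
  refine forall_congr' fun W => forall_congr' fun hb => forall_congr' fun _ => ?_
  have h := W.finrank_add_pos hV hb
  obtain ⟨_, _⟩ := hV
  have h₀ := W.W₀.finrank_le
  have h₁ := W.W₁.finrank_le
  rw [Sub.slope, Sub.theta, slope, theta,
    slope_lt_iff hΘ (by exact_mod_cast h) (by exact_mod_cast (by omega))]
  exact_mod_cast Iff.rfl

/-- The kernel of a morphism, as a subrepresentation. -/
def Hom.kerSub {V : QuiverRep.{u}} {V' : QuiverRep.{v}} (φ : V.Hom V') : V.Sub where
  W₀ := LinearMap.ker φ.f₀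
  W₁ := LinearMap.ker φ.f₁
  a_mem i x hx := by rw [LinearMap.mem_ker] at *; rw [φ.comm_a, hx, map_zero]
  b_mem i x hx := by rw [LinearMap.mem_ker] at *; rw [φ.comm_b, hx, map_zero]
  c_mem x hx := by rw [LinearMap.mem_ker] at *; rw [φ.comm_c, hx, map_zero]
  d_mem x hx := by rw [LinearMap.mem_ker] at *; rw [φ.comm_d, hx, map_zero]

/-- The image of a morphism, as a subrepresentation. -/
def Hom.rangeSub {V : QuiverRep.{u}} {V' : QuiverRep.{v}} (φ : V.Hom V') : V'.Sub where
  W₀ := LinearMap.range φ.f₀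
  W₁ := LinearMap.range φ.f₁
  a_mem := by rintro i _ ⟨x, rfl⟩; exact ⟨_, φ.comm_a i x⟩
  b_mem := by rintro i _ ⟨x, rfl⟩; exact ⟨_, φ.comm_b i x⟩
  c_mem := by rintro _ ⟨x, rfl⟩; exact ⟨_, φ.comm_c x⟩
  d_mem := by rintro _ ⟨x, rfl⟩; exact ⟨_, φ.comm_d x⟩

/-- Schur's lemma for stable representations of the same dimension. -/
theorem NegStable.bijective {V : QuiverRep.{u}} {V' : QuiverRep.{v}} (hV : V.NegStable)
    (hV' : V'.NegStable) (hf : V.IsFinite) (hf' : V'.IsFinite)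
    (h₀ : Module.finrank ℂ V.V₀ = Module.finrank ℂ V'.V₀)
    (h₁ : Module.finrank ℂ V.V₁ = Module.finrank ℂ V'.V₁) (φ : V.Hom V')
    (hφ : ¬ (φ.f₀ = 0 ∧ φ.f₁ = 0)) : Function.Bijective φ.f₀ ∧ Function.Bijective φ.f₁ := by
  obtain ⟨_, _⟩ := hf
  obtain ⟨_, _⟩ := hf'
  have hb : φ.kerSub.IsBot := by
    by_contra hb
    have e₀ := φ.f₀.finrank_range_add_finrank_ker
    have e₁ := φ.f₁.finrank_range_add_finrank_ker
    have hk := hV φ.kerSub hb fun h => hφ ⟨LinearMap.ker_eq_top.1 h.1, LinearMap.ker_eq_top.1 h.2⟩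
    have hr := hV' φ.rangeSub
      (fun h => hφ ⟨LinearMap.range_eq_bot.1 h.1, LinearMap.range_eq_bot.1 h.2⟩) fun h => by
        refine hb ⟨LinearMap.ker_eq_bot.2 ?_, LinearMap.ker_eq_bot.2 ?_⟩
        · exact (LinearMap.injective_iff_surjective_of_finrank_eq_finrank h₀).2
            (LinearMap.range_eq_top.1 h.1)
        · exact (LinearMap.injective_iff_surjective_of_finrank_eq_finrank h₁).2
            (LinearMap.range_eq_top.1 h.2)
    change Module.finrank ℂ (LinearMap.ker φ.f₁) * _ < _ * Module.finrank ℂ (LinearMap.ker φ.f₀)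
      at hk
    change Module.finrank ℂ (LinearMap.range φ.f₁) * _ <
      _ * Module.finrank ℂ (LinearMap.range φ.f₀) at hr
    rw [← h₀, ← h₁] at hr
    -- By rank-nullity the dimension vectors of kernel and image add up to that of `V`, so the sum
    -- of `hk` and `hr` has the same product on both sides of a strict inequality.
    nlinarith
  have i₀ := LinearMap.ker_eq_bot.1 hb.1
  have i₁ := LinearMap.ker_eq_bot.1 hb.2
  exact ⟨⟨i₀, (LinearMap.injective_iff_surjective_of_finrank_eq_finrank h₀).1 i₀⟩,
    ⟨i₁, (LinearMap.injective_iff_surjective_of_finrank_eq_finrank h₁).1 i₁⟩⟩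

/-- Endomorphisms of stable representations are scalars. -/
theorem NegStable.exists_eq_smul {V : QuiverRep.{u}} (hV : V.NegStable) (hf : V.IsFinite)
    (hz : ¬ V.IsZero) (φ : V.Hom V) :
    ∃ t : ℂ, (∀ x, φ.f₀ x = t • x) ∧ ∀ y, φ.f₁ y = t • y := by
  -- `φ - t` is again a morphism, hence zero or bijective. For an eigenvalue `t` of `φ` at either
  -- vertex it is not injective, so it is zero.
  have key (t : ℂ) (h : ¬ (Function.Injective ⇑(φ.f₀ - t • (LinearMap.id : V.V₀ →ₗ[ℂ] V.V₀)) ∧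
      Function.Injective ⇑(φ.f₁ - t • (LinearMap.id : V.V₁ →ₗ[ℂ] V.V₁)))) :
      (∀ x, φ.f₀ x = t • x) ∧ ∀ y, φ.f₁ y = t • y := by
    let ψ : V.Hom V := ⟨φ.f₀ - t • LinearMap.id, φ.f₁ - t • LinearMap.id,
      fun i x => by simp [φ.comm_a], fun i x => by simp [φ.comm_b],
      fun x => by simp [φ.comm_c], fun x => by simp [φ.comm_d]⟩
    have hψ : ψ.f₀ = 0 ∧ ψ.f₁ = 0 := by
      by_contra hψ
      have := hV.bijective hV hf hf rfl rfl ψ hψ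
      exact h ⟨this.1.1, this.2.1⟩
    exact ⟨fun x => sub_eq_zero.1 (LinearMap.congr_fun hψ.1 x),
      fun x => sub_eq_zero.1 (LinearMap.congr_fun hψ.2 x)⟩
  obtain ⟨_, _⟩ := hf
  rw [IsZero, not_and_or, not_subsingleton_iff_nontrivial, not_subsingleton_iff_nontrivial] at hz
  obtain hz | hz := hz
  · obtain ⟨t, ht⟩ := Module.End.exists_eigenvalue φ.f₀
    obtain ⟨x, hx⟩ := ht.exists_hasEigenvector
    refine ⟨t, key t fun h => hx.2 (h.1 ?_)⟩
    simp [hx.apply_eq_smul]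
  · obtain ⟨t, ht⟩ := Module.End.exists_eigenvalue φ.f₁
    obtain ⟨x, hx⟩ := ht.exists_hasEigenvector
    refine ⟨t, key t fun h => hx.2 (h.2 ?_)⟩
    simp [hx.apply_eq_smul]

end QuiverRep

/-- The dimensions force `f` to be an isomorphism, and `f⁻¹ g` has an eigenvector over `ℂ`. -/
theorem exists_pencil_eigenvector {E F : Type*} [AddCommGroup E] [AddCommGroup F] [Module ℂ E]
    [Module ℂ F] [FiniteDimensional ℂ E] [FiniteDimensional ℂ F] [Nontrivial E] (f g : E →ₗ[ℂ] F)
    (hf : Function.Injective f) (h : Module.finrank ℂ F ≤ Module.finrank ℂ E) :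
    ∃ x ≠ 0, ∃ l : ℂ, g x = l • f x := by
  let e := LinearEquiv.ofInjectiveOfFinrankEq f hf
    (le_antisymm (LinearMap.finrank_le_finrank_of_injective hf) h)
  obtain ⟨l, hl⟩ := Module.End.exists_eigenvalue (e.symm.toLinearMap.comp g)
  obtain ⟨x, hx⟩ := hl.exists_hasEigenvector
  refine ⟨x, hx.2, l, ?_⟩
  have : e (e.symm (g x)) = e (l • x) := congrArg e hx.apply_eq_smul
  rwa [e.apply_symm_apply, map_smul] at this

/-! ### Reduction to the Kronecker quiver and its Euler form. -/

namespace QuiverRep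

/-- The loops form an endomorphism. -/
def loopHom (V : QuiverRep.{u}) : V.Hom V where
  f₀ := V.c
  f₁ := V.d
  comm_a := V.rel_da
  comm_b := V.rel_cb
  comm_c _ := rfl
  comm_d _ := rfl

/-- The cycles `bᵢ aⱼ` and `aⱼ bᵢ` form an endomorphism. -/
def cycleHom (V : QuiverRep.{u}) (i j : Fin 2) : V.Hom V where
  f₀ := (V.b i).comp (V.a j)
  f₁ := (V.a j).comp (V.b i)
  comm_a k x := by
    -- The claim is `aⱼ bᵢ aₖ = aₖ bᵢ aⱼ`: trivial for `j = k`, and one of the relations otherwise.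
    have := V.rel_aba i x
    fin_cases j <;> fin_cases k <;> simp [this]
  comm_b k x := by
    have := V.rel_bab j x
    fin_cases i <;> fin_cases k <;> simp [this]
  comm_c x := by simp [V.rel_da, V.rel_cb]
  comm_d x := by simp [V.rel_da, V.rel_cb]

/-- The loops act as the scalar `t`. -/
def LoopsEq (V : QuiverRep.{u}) (t : ℂ) : Prop := (∀ x, V.c x = t • x) ∧ ∀ y, V.d y = t • y

theorem NegStable.exists_loopsEq {V : QuiverRep.{u}} (hV : V.NegStable) (hf : V.IsFinite)
    (hz : ¬ V.IsZero) : ∃ t, V.LoopsEq t :=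
  hV.exists_eq_smul hf hz V.loopHom

/-- All cycles are scalars, and a non-zero one makes `aⱼ` and `bᵢ` injective, so both vertices have
the same dimension. The lines through `x` and `aⱼ x` form a subrepresentation of dimension `(1, 1)`.
Its ratio of dimensions equals that of `V`, so stability leaves only the case that it is all of `V`.
-/
theorem NegStable.finrank_eq_one_of_cycle {V : QuiverRep.{u}} (hV : V.NegStable) (hf : V.IsFinite)
    (hz : ¬ V.IsZero) {i j : Fin 2} (h : ¬ ∀ x, V.b i (V.a j x) = 0) :
    Module.finrank ℂ V.V₀ = 1 ∧ Module.finrank ℂ V.V₁ = 1 := by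
  choose l hl₀ hl₁ using fun i j => hV.exists_eq_smul hf hz (V.cycleHom i j)
  simp only [cycleHom, LinearMap.comp_apply] at hl₀ hl₁
  obtain ⟨t, hc, hd⟩ := hV.exists_loopsEq hf hz
  obtain ⟨_, _⟩ := hf
  push Not at h
  obtain ⟨x, hx⟩ := h
  have hl : l i j ≠ 0 := fun h => hx (by rw [hl₀, h, zero_smul])
  have hax : V.a j x ≠ 0 := fun h => hx (by rw [h, map_zero])
  have hx0 : x ≠ 0 := fun h => hx (by rw [h, map_zero, map_zero])
  have ja : Function.Injective (V.a j) := by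
    refine (injective_iff_map_eq_zero _).2 fun y hy => ?_
    have := hl₀ i j y
    rw [hy, map_zero, eq_comm, smul_eq_zero] at this
    exact this.resolve_left hl
  have jb : Function.Injective (V.b i) := by
    refine (injective_iff_map_eq_zero _).2 fun y hy => ?_
    have := hl₁ i j y
    rw [hy, map_zero, eq_comm, smul_eq_zero] at this
    exact this.resolve_left hl
  have hdim := le_antisymm (LinearMap.finrank_le_finrank_of_injective ja)
    (LinearMap.finrank_le_finrank_of_injective jb)
  let W : V.Sub :=
    { W₀ := Submodule.span ℂ {x}
      W₁ := Submodule.span ℂ {V.a j x}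
      a_mem := fun k y hy => by
        obtain ⟨r, rfl⟩ := Submodule.mem_span_singleton.1 hy
        rw [map_smul]
        -- The coefficient comes from evaluating `aⱼ bᵢ aₖ x` in two ways, as `l i j • aₖ x` and as
        -- `l i k • aⱼ x`.
        refine Submodule.smul_mem _ _ (Submodule.mem_span_singleton.2 ⟨(l i j)⁻¹ * l i k, ?_⟩)
        rw [mul_smul, inv_smul_eq_iff₀ hl, ← map_smul, ← hl₀, hl₁]
      b_mem := fun k y hy => by
        obtain ⟨r, rfl⟩ := Submodule.mem_span_singleton.1 hy
        rw [map_smul, hl₀]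
        exact Submodule.smul_mem _ _ (Submodule.smul_mem _ _ (Submodule.mem_span_singleton_self _))
      c_mem := fun y hy => by rw [hc]; exact Submodule.smul_mem _ _ hy
      d_mem := fun y hy => by rw [hd]; exact Submodule.smul_mem _ _ hy }
  have r₀ : Module.finrank ℂ W.W₀ = 1 := finrank_span_singleton hx0
  have r₁ : Module.finrank ℂ W.W₁ = 1 := finrank_span_singleton hax
  by_cases ht : W.IsTop
  · rw [ht.1, finrank_top] at r₀
    rw [ht.2, finrank_top] at r₁
    exact ⟨r₀, r₁⟩
  · have := hV W (fun h => hx0 (Submodule.span_singleton_eq_bot.1 h.1)) ht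
    rw [r₀, r₁, hdim] at this
    omega

/-- For `θ₀ < θ₁`, the maps `aᵢ` of a stable representation vanish, unless its dimension vector is
`(1, 1)`. -/
theorem NegStable.a_eq_zero {V : QuiverRep.{u}} (hV : V.NegStable) (hf : V.IsFinite)
    (hz : ¬ V.IsZero) (h : ¬ (Module.finrank ℂ V.V₀ = 1 ∧ Module.finrank ℂ V.V₁ = 1)) (i : Fin 2) :
    V.a i = 0 := by
  have hba (i j : Fin 2) (x) : V.b i (V.a j x) = 0 := by
    by_contra hx
    exact h (hV.finrank_eq_one_of_cycle hf hz fun h' => hx (h' x))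
  by_contra ha
  obtain ⟨x, hx⟩ := DFunLike.ne_iff.1 ha
  -- This is the largest subrepresentation that vanishes at vertex `0`. As all cycles are zero it
  -- contains `aᵢ x ≠ 0`, while stability for `θ₀ < θ₁` does not allow it to be non-zero and proper.
  let W : V.Sub :=
    { W₀ := ⊥
      W₁ := ⨅ i, LinearMap.ker (V.b i)
      a_mem := fun i x hx => by rw [(Submodule.mem_bot ℂ).1 hx, map_zero]; exact zero_mem _
      b_mem := fun i y hy => (Submodule.mem_iInf _).1 hy i
      c_mem := fun x hx => by rw [(Submodule.mem_bot ℂ).1 hx, map_zero]; exact zero_mem _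
      d_mem := fun y hy => (Submodule.mem_iInf _).2 fun i => by
        rw [LinearMap.mem_ker, ← V.rel_cb, (Submodule.mem_iInf _).1 hy i, map_zero] }
  have hmem : V.a i x ∈ W.W₁ := (Submodule.mem_iInf _).2 fun j => hba j i x
  have := hV W (fun h => hx ((Submodule.mem_bot ℂ).1 (h.2 ▸ hmem))) fun h => hx (by
    have : x ∈ W.W₀ := by rw [h.1]; trivial
    rw [(Submodule.mem_bot ℂ).1 this, map_zero, map_zero])
  rw [show Module.finrank ℂ W.W₀ = 0 from finrank_bot _ _] at this
  omega

/-- `V` is a representation of the Kronecker quiver with arrows `bᵢ`, on which the loops act as `t`. -/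
structure IsKronecker (V : QuiverRep.{u}) (t : ℂ) : Prop where
  a_eq : ∀ i, V.a i = 0
  loops : V.LoopsEq t

/-- The obstruction to a pair of linear maps commuting with the `bᵢ`. -/
def kroneckerMap (V : QuiverRep.{u}) (V' : QuiverRep.{v}) :
    ((V.V₀ →ₗ[ℂ] V'.V₀) × (V.V₁ →ₗ[ℂ] V'.V₁)) →ₗ[ℂ] (Fin 2 → (V.V₁ →ₗ[ℂ] V'.V₀)) :=
  LinearMap.pi fun i => (LinearMap.lcomp ℂ V'.V₀ (V.b i)).comp (LinearMap.fst ℂ _ _) -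
    ((V'.b i).compRight ℂ).comp (LinearMap.snd ℂ _ _)

theorem mem_ker_kroneckerMap {V : QuiverRep.{u}} {V' : QuiverRep.{v}} {p} :
    p ∈ LinearMap.ker (kroneckerMap V V') ↔ ∀ i y, p.1 (V.b i y) = V'.b i (p.2 y) := by
  rw [LinearMap.mem_ker, funext_iff]
  refine forall_congr' fun i => ?_
  rw [LinearMap.ext_iff]
  exact forall_congr' fun y => sub_eq_zero

/-- A pair of linear maps that commutes with the `bᵢ`, as a morphism. -/
def kroneckerHom {V : QuiverRep.{u}} {V' : QuiverRep.{v}} {t : ℂ} (h : V.IsKronecker t)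
    (h' : V'.IsKronecker t) {p} (hp : p ∈ LinearMap.ker (kroneckerMap V V')) : V.Hom V' where
  f₀ := p.1
  f₁ := p.2
  comm_a i x := by rw [h.a_eq, h'.a_eq]; simp
  comm_b := mem_ker_kroneckerMap.1 hp
  comm_c x := by rw [h.loops.1, h'.loops.1, map_smul]
  comm_d x := by rw [h.loops.2, h'.loops.2, map_smul]

/-- Rank-nullity: the dimension of the space of morphisms is at least the Euler form, the dimension
of the source of `kroneckerMap` minus that of its target. -/
theorem finrank_ker_kroneckerMap {V : QuiverRep.{u}} {V' : QuiverRep.{v}} (hf : V.IsFinite)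
    (hf' : V'.IsFinite) :
    Module.finrank ℂ V.V₀ * Module.finrank ℂ V'.V₀ + Module.finrank ℂ V.V₁ * Module.finrank ℂ V'.V₁ ≤
      Module.finrank ℂ (LinearMap.ker (kroneckerMap V V')) +
        2 * (Module.finrank ℂ V.V₁ * Module.finrank ℂ V'.V₀) := by
  obtain ⟨_, _⟩ := hf
  obtain ⟨_, _⟩ := hf'
  have h₁ := (kroneckerMap V V').finrank_range_add_finrank_ker
  have h₂ := (LinearMap.range (kroneckerMap V V')).finrank_le
  rw [Module.finrank_pi_fintype] at h₂
  simp only [Module.finrank_prod, Module.finrank_linearMap, Finset.sum_const, Finset.card_univ,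
    Fintype.card_fin, smul_eq_mul] at h₁ h₂
  omega

/-- For equal dimension vectors `(x, y)` the Euler form is `(x - y)²`, positive by `hne`. So there
is a non-zero morphism, and Schur's lemma makes it bijective. -/
theorem NegStable.isomorphic_of_finrank_eq {V : QuiverRep.{u}} {V' : QuiverRep.{v}}
    (hV : V.NegStable) (hV' : V'.NegStable) (hf : V.IsFinite) (hf' : V'.IsFinite)
    (h₀ : Module.finrank ℂ V.V₀ = Module.finrank ℂ V'.V₀)
    (h₁ : Module.finrank ℂ V.V₁ = Module.finrank ℂ V'.V₁)
    (hne : Module.finrank ℂ V.V₀ ≠ Module.finrank ℂ V.V₁)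
    {t : ℂ} (hk : V.IsKronecker t) (hk' : V'.IsKronecker t) : V.Isomorphic V' := by
  have h := finrank_ker_kroneckerMap hf hf'
  rw [← h₀, ← h₁] at h
  have hpos : 0 < Module.finrank ℂ (LinearMap.ker (kroneckerMap V V')) := by
    by_contra! h0
    generalize Module.finrank ℂ V.V₀ = x at *
    generalize Module.finrank ℂ V.V₁ = y at *
    rw [Nat.le_zero.1 h0, zero_add] at h
    zify at h hne
    nlinarith [sq_pos_of_ne_zero (sub_ne_zero.2 hne)]
  have := Module.nontrivial_of_finrank_pos hpos
  obtain ⟨⟨p, hp⟩, hne⟩ := exists_ne (0 : LinearMap.ker (kroneckerMap V V'))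
  exact ⟨kroneckerHom hk hk' hp, hV.bijective hV' hf hf' h₀ h₁ _ fun h =>
    hne (Subtype.ext (Prod.ext h.1 h.2))⟩

/-- Endomorphisms are scalars, so the Euler form gives `(x - y)² ≤ 1`. -/
theorem NegStable.finrank_le {V : QuiverRep.{u}} (hV : V.NegStable) (hf : V.IsFinite)
    (hz : ¬ V.IsZero) {t : ℂ} (hk : V.IsKronecker t) :
    Module.finrank ℂ V.V₀ ≤ Module.finrank ℂ V.V₁ + 1 ∧
      Module.finrank ℂ V.V₁ ≤ Module.finrank ℂ V.V₀ + 1 := by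
  have h := finrank_ker_kroneckerMap hf hf
  have hle : Module.finrank ℂ (LinearMap.ker (kroneckerMap V V)) ≤ 1 := by
    refine finrank_le_one ⟨(LinearMap.id, LinearMap.id),
      mem_ker_kroneckerMap.2 fun _ _ => rfl⟩ fun p => ?_
    obtain ⟨l, h₀, h₁⟩ := hV.exists_eq_smul hf hz (kroneckerHom hk hk p.2)
    exact ⟨l, Subtype.ext (Prod.ext (LinearMap.ext fun x => (h₀ x).symm)
      (LinearMap.ext fun x => (h₁ x).symm))⟩
  generalize Module.finrank ℂ V.V₀ = x at *
  generalize Module.finrank ℂ V.V₁ = y at *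
  constructor <;> by_contra! h' <;> nlinarith

/-- A vector `x ≠ 0` at vertex `1` whose images under both `bᵢ` lie on one line generates a
subrepresentation of dimension `(1, 1)` or `(0, 1)`. In a stable representation of dimension `(n,
n)` this can only be everything. -/
theorem NegStable.finrank_eq_one {V : QuiverRep.{u}} (hV : V.NegStable) (hf : V.IsFinite)
    (hz : ¬ V.IsZero) {t : ℂ} (hk : V.IsKronecker t)
    (heq : Module.finrank ℂ V.V₀ = Module.finrank ℂ V.V₁) :
    Module.finrank ℂ V.V₁ = 1 := by
  obtain ⟨_, _⟩ := hf
  have hnt : Nontrivial V.V₁ := by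
    by_contra h
    rw [not_nontrivial_iff_subsingleton] at h
    refine hz ⟨?_, h⟩
    rw [Module.finrank_zero_of_subsingleton (M := V.V₁)] at heq
    exact Module.finrank_zero_iff.1 heq
  -- If `b₀` is injective, take an eigenvector of the pencil, so that `b₁ x` is a multiple of `b₀
  -- x`; otherwise take `x` in the kernel of `b₀`.
  have hx : ∃ x ≠ 0, ∃ y, ∀ i, V.b i x ∈ Submodule.span ℂ {y} := by
    by_cases hi : Function.Injective (V.b 0)
    · obtain ⟨x, hx, l, hl⟩ := exists_pencil_eigenvector (V.b 0) (V.b 1) hi heq.le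
      refine ⟨x, hx, V.b 0 x, fun i => ?_⟩
      fin_cases i
      · exact Submodule.mem_span_singleton_self _
      · exact Submodule.mem_span_singleton.2 ⟨l, hl.symm⟩
    · rw [injective_iff_map_eq_zero] at hi
      push Not at hi
      obtain ⟨x, h, hx⟩ := hi
      refine ⟨x, hx, V.b 1 x, fun i => ?_⟩
      fin_cases i
      · change V.b 0 x ∈ _
        rw [h]; exact zero_mem _
      · exact Submodule.mem_span_singleton_self _
  obtain ⟨x, hx, y, hy⟩ := hx
  let W : V.Sub :=
    { W₀ := Submodule.span ℂ {y}
      W₁ := Submodule.span ℂ {x}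
      a_mem := fun i _ _ => by rw [hk.a_eq]; exact zero_mem _
      b_mem := fun i z hz => by
        obtain ⟨r, rfl⟩ := Submodule.mem_span_singleton.1 hz
        rw [map_smul]
        exact Submodule.smul_mem _ _ (hy i)
      c_mem := fun y hy => by rw [hk.loops.1]; exact Submodule.smul_mem _ _ hy
      d_mem := fun y hy => by rw [hk.loops.2]; exact Submodule.smul_mem _ _ hy }
  have r₀ : Module.finrank ℂ W.W₀ ≤ 1 := (finrank_span_le_card {y}).trans (by simp)
  have r₁ : Module.finrank ℂ W.W₁ = 1 := finrank_span_singleton hx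
  by_cases ht : W.IsTop
  · rwa [ht.2, finrank_top] at r₁
  · have := hV W (fun h => hx (Submodule.span_singleton_eq_bot.1 h.2)) ht
    rw [r₁, heq] at this
    nlinarith

end QuiverRep

/-! ### The three families of models, their stability, and the classification. -/

namespace QuiverRep

/-- Multiplication by `Xⁱ`, `i = 0, 1`, on polynomials of bounded degree. -/
def mulPowX (n : ℕ) (i : Fin 2) : Polynomial.degreeLT ℂ n →ₗ[ℂ] Polynomial.degreeLT ℂ (n + 1) :=
  (LinearMap.mulLeft ℂ ((Polynomial.X : ℂ[X]) ^ (i : ℕ))).restrict fun p hp => by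
    rw [Polynomial.mem_degreeLT] at *
    rw [LinearMap.mulLeft_apply]
    fin_cases i
    · rw [Fin.zero_eta, Fin.val_zero, pow_zero, one_mul]
      exact hp.trans (by exact_mod_cast n.lt_succ_self)
    · rw [Fin.mk_one, Fin.val_one, pow_one, mul_comm, Polynomial.degree_mul_X]
      exact_mod_cast WithBot.add_lt_add_right WithBot.one_ne_bot hp

theorem coe_mulPowX (n : ℕ) (i : Fin 2) (p : Polynomial.degreeLT ℂ n) :
    (mulPowX n i p : ℂ[X]) = Polynomial.X ^ (i : ℕ) * (p : ℂ[X]) :=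
  rfl

/-- The preprojective Kronecker module of dimension vector `(n + 1, n)`: polynomials of degree
`< n`, the inclusion and multiplication by `X`. -/
def preprojective (t : ℂ) (n : ℕ) : QuiverRep.{0} where
  V₀ := Polynomial.degreeLT ℂ (n + 1)
  V₁ := Polynomial.degreeLT ℂ n
  a _ := 0
  b := mulPowX n
  c := t • LinearMap.id
  d := t • LinearMap.id
  rel_aba _ _ := rfl
  rel_bab _ _ := by simp
  rel_da _ _ := by simp
  rel_cb _ _ := by simp

theorem finrank_degreeLT (n : ℕ) : Module.finrank ℂ (Polynomial.degreeLT ℂ n) = n := by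
  rw [(Polynomial.degreeLTEquiv ℂ n).finrank_eq, Module.finrank_fin_fun]

theorem isFinite_preprojective (t : ℂ) (n : ℕ) : (preprojective t n).IsFinite :=
  ⟨Module.Finite.equiv (Polynomial.degreeLTEquiv ℂ (n + 1)).symm,
    Module.Finite.equiv (Polynomial.degreeLTEquiv ℂ n).symm⟩

theorem isKronecker_preprojective (t : ℂ) (n : ℕ) : (preprojective t n).IsKronecker t :=
  ⟨fun _ => rfl, fun _ => rfl, fun _ => rfl⟩

theorem injective_mulPowX (n : ℕ) (i : Fin 2) : Function.Injective (mulPowX n i) := by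
  intro p q h
  have h := congrArg Subtype.val h
  rw [coe_mulPowX, coe_mulPowX] at h
  exact Subtype.ext (mul_left_cancel₀ (pow_ne_zero _ Polynomial.X_ne_zero) h)

/-- The hypothesis reads `(X - l) p = 0` in a domain. This absence of pencil eigenvectors is what
makes `preprojective` stable. -/
theorem eq_zero_of_mulPowX_one_eq {n : ℕ} {p : Polynomial.degreeLT ℂ n} {l : ℂ}
    (h : mulPowX n 1 p = l • mulPowX n 0 p) : p = 0 := by
  have h := congrArg Subtype.val h
  rw [Submodule.coe_smul, coe_mulPowX, coe_mulPowX, Fin.val_zero, Fin.val_one, pow_zero, one_mul,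
    pow_one, Polynomial.smul_eq_C_mul, ← sub_eq_zero, ← sub_mul, mul_eq_zero] at h
  exact Subtype.ext (h.resolve_left (Polynomial.X_sub_C_ne_zero l))

/-- If `W₁ ≠ 0` had dimension at least that of `W₀`, the pencil restricted to `W` would have an
eigenvector, which does not exist. So `dim W₁ < dim W₀` unless `W₁ = 0`, and the inequality follows
by arithmetic. -/
theorem negStable_preprojective (t : ℂ) (n : ℕ) : (preprojective t n).NegStable := by
  intro W hb ht
  have e₀ : Module.finrank ℂ (preprojective t n).V₀ = n + 1 := finrank_degreeLT _
  have e₁ : Module.finrank ℂ (preprojective t n).V₁ = n := finrank_degreeLT _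
  have hpos := W.finrank_add_pos (isFinite_preprojective t n) hb
  obtain ⟨_, _⟩ := isFinite_preprojective t n
  have l₀ := W.W₀.finrank_le
  have l₁ := W.W₁.finrank_le
  have ht' : ¬ (Module.finrank ℂ W.W₀ = n + 1 ∧ Module.finrank ℂ W.W₁ = n) := fun h =>
    ht ⟨Submodule.eq_top_of_finrank_eq (h.1.trans e₀.symm),
      Submodule.eq_top_of_finrank_eq (h.2.trans e₁.symm)⟩
  have key : Module.finrank ℂ W.W₁ ≠ 0 → Module.finrank ℂ W.W₁ < Module.finrank ℂ W.W₀ := by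
    intro h
    by_contra! hle
    have := Module.nontrivial_of_finrank_pos (Nat.pos_of_ne_zero h)
    obtain ⟨x, hx, l, hl⟩ := exists_pencil_eigenvector
      (((preprojective t n).b 0).restrict (W.b_mem 0)) (((preprojective t n).b 1).restrict (W.b_mem 1))
      (fun x y h => Subtype.ext (injective_mulPowX n 0 (congrArg Subtype.val h))) hle
    exact hx (Subtype.ext (eq_zero_of_mulPowX_one_eq (congrArg Subtype.val hl)))
  rw [e₀, e₁]
  rw [e₀] at l₀
  rw [e₁] at l₁
  by_cases h : Module.finrank ℂ W.W₁ = 0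
  · rw [h, zero_mul]
    exact Nat.mul_pos (by omega) (by omega)
  · have := key h
    -- Dimension `n` at vertex `1` would force `n + 1` at vertex `0`, that is, the whole
    -- representation.
    have : Module.finrank ℂ W.W₁ < n := by omega
    nlinarith

/-- The preinjective Kronecker module of dimension vector `(n, n + 1)`: the two shift maps on
sequences of length `n + 1`. -/
def preinjective (t : ℂ) (n : ℕ) : QuiverRep.{0} where
  V₀ := Fin n → ℂ
  V₁ := Fin (n + 1) → ℂ
  a _ := 0
  b i := LinearMap.funLeft ℂ ℂ (![Fin.castSucc, Fin.succ] i)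
  c := t • LinearMap.id
  d := t • LinearMap.id
  rel_aba _ _ := rfl
  rel_bab _ _ := by simp
  rel_da _ _ := by simp
  rel_cb _ _ := by simp

theorem isFinite_preinjective (t : ℂ) (n : ℕ) : (preinjective t n).IsFinite :=
  ⟨inferInstanceAs (FiniteDimensional ℂ (Fin n → ℂ)),
    inferInstanceAs (FiniteDimensional ℂ (Fin (n + 1) → ℂ))⟩

theorem isKronecker_preinjective (t : ℂ) (n : ℕ) : (preinjective t n).IsKronecker t :=
  ⟨fun _ => rfl, fun _ => rfl, fun _ => rfl⟩

/-- Only `dim W₀ < dim W₁` could violate the inequality. Then every `b₁ - l b₀` has a kernel on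
`W₁`, and a vector killed by it is a geometric sequence of ratio `l`. So `W₁` contains all geometric
sequences, which span, and `b₀` maps `V₁` onto `V₀`; hence `W` is everything. -/
theorem negStable_preinjective (t : ℂ) (n : ℕ) : (preinjective t n).NegStable := by
  intro W hb ht
  have e₀ : Module.finrank ℂ (preinjective t n).V₀ = n := Module.finrank_fin_fun ℂ
  have e₁ : Module.finrank ℂ (preinjective t n).V₁ = n + 1 := Module.finrank_fin_fun ℂ
  have hpos := W.finrank_add_pos (isFinite_preinjective t n) hb
  obtain ⟨_, _⟩ := isFinite_preinjective t n
  rw [e₀, e₁]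
  rcases le_or_gt (Module.finrank ℂ W.W₁) (Module.finrank ℂ W.W₀) with hle | hlt
  · nlinarith
  exfalso
  have hmem (l : ℂ) : (fun i : Fin (n + 1) => l ^ (i : ℕ)) ∈ W.W₁ := by
    obtain ⟨x, hx, hx0⟩ := (Submodule.ne_bot_iff _).1 (LinearMap.ker_ne_bot_of_finrank_lt
      (f := ((preinjective t n).b 1).restrict (W.b_mem 1) -
        l • ((preinjective t n).b 0).restrict (W.b_mem 0)) hlt)
    rw [LinearMap.mem_ker, LinearMap.sub_apply, sub_eq_zero] at hx
    have hx : ∀ i : Fin n, x.1 i.succ = l * x.1 i.castSucc := congrFun (congrArg Subtype.val hx)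
    have hval (i : Fin (n + 1)) : x.1 i = l ^ (i : ℕ) * x.1 0 := by
      induction i using Fin.induction with
      | zero => simp
      | succ i ih => rw [hx, ih]; simp; ring
    have h0 : x.1 0 ≠ 0 := fun h => hx0 (Subtype.ext (funext fun i => by
      rw [hval, h, mul_zero]; rfl))
    have : (fun i : Fin (n + 1) => l ^ (i : ℕ)) = (x.1 0)⁻¹ • x.1 := funext fun i => by
      change _ = (x.1 0)⁻¹ * x.1 i
      rw [hval i, mul_comm, mul_assoc, mul_inv_cancel₀ h0, mul_one]
    rw [this]
    exact W.W₁.smul_mem _ x.2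
  -- The rows of this Vandermonde matrix are the geometric sequences with the `n + 1` distinct
  -- ratios `0, …, n`.
  have hli : LinearIndependent ℂ (Matrix.vandermonde fun i : Fin (n + 1) => ((i : ℕ) : ℂ)) := by
    refine Matrix.linearIndependent_rows_of_det_ne_zero (Matrix.det_vandermonde_ne_zero_iff.2 ?_)
    exact fun i j h => Fin.ext (Nat.cast_injective h)
  have h₁ : W.W₁ = ⊤ := by
    refine eq_top_iff.2 ((hli.span_eq_top_of_card_eq_finrank' (by simp)).ge.trans ?_)
    refine Submodule.span_le.2 ?_
    rintro _ ⟨i, rfl⟩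
    exact hmem i
  refine ht ⟨eq_top_iff.2 fun y _ => ?_, h₁⟩
  -- `b₀` forgets the last entry, so appending `0` gives a preimage.
  let x : Fin (n + 1) → ℂ := Fin.snoc (α := fun _ => ℂ) y 0
  have : (preinjective t n).b 0 x = y :=
    funext fun i => Fin.snoc_castSucc (α := fun _ => ℂ) (0 : ℂ) y i
  rw [← this]
  exact W.b_mem 0 _ (h₁ ▸ trivial)

/-- The representation of dimension vector `(1, 1)` that corresponds to a point. -/
def point (s w : Fin 2 → ℂ) (t : ℂ) : QuiverRep.{0} where
  V₀ := ℂ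
  V₁ := ℂ
  a i := w i • LinearMap.id
  b i := s i • LinearMap.id
  c := t • LinearMap.id
  d := t • LinearMap.id
  rel_aba _ _ := by simp; ring
  rel_bab _ _ := by simp; ring
  rel_da _ _ := by simp; ring
  rel_cb _ _ := by simp; ring

theorem isFinite_point (s w : Fin 2 → ℂ) (t : ℂ) : (point s w t).IsFinite :=
  ⟨inferInstanceAs (FiniteDimensional ℂ ℂ), inferInstanceAs (FiniteDimensional ℂ ℂ)⟩

/-- As some `sᵢ` is non-zero, `V₁` generates `V`. So a proper subrepresentation vanishes at vertex
`1`. -/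
theorem negStable_point {s : Fin 2 → ℂ} (hs : s ≠ 0) (w : Fin 2 → ℂ) (t : ℂ) :
    (point s w t).NegStable := by
  intro W hb ht
  have e₀ : Module.finrank ℂ (point s w t).V₀ = 1 := Module.finrank_self ℂ
  have e₁ : Module.finrank ℂ (point s w t).V₁ = 1 := Module.finrank_self ℂ
  have hpos := W.finrank_add_pos (isFinite_point s w t) hb
  obtain ⟨_, _⟩ := isFinite_point s w t
  have l₁ := W.W₁.finrank_le
  rw [e₁] at l₁
  rw [e₀, e₁, mul_one, one_mul]
  by_contra! hle
  have h₁ : W.W₁ = ⊤ := Submodule.eq_top_of_finrank_eq (by omega)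
  obtain ⟨i, hi⟩ := Function.ne_iff.1 hs
  refine ht ⟨eq_top_iff.2 fun y _ => ?_, h₁⟩
  have : (point s w t).b i ((s i)⁻¹ • y) = y := smul_inv_smul₀ hi y
  rw [← this]
  exact W.b_mem i _ (h₁ ▸ trivial)

/-- In chosen bases the `bᵢ`, `aᵢ` and the loops are numbers, and these are the homogeneous
coordinates of the point. They satisfy `s ≠ 0`, since otherwise `(0, V₁)` would be a destabilizing
subrepresentation. -/
theorem NegStable.exists_point {V : QuiverRep.{u}} (hV : V.NegStable) (hf : V.IsFinite)
    (h₀ : Module.finrank ℂ V.V₀ = 1) (h₁ : Module.finrank ℂ V.V₁ = 1) {t : ℂ} (ht : V.LoopsEq t) :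
    ∃ x : HPoint, (point x.s x.w x.t).Isomorphic V := by
  obtain ⟨_, _⟩ := hf
  let e₀ : V.V₀ ≃ₗ[ℂ] ℂ := LinearEquiv.ofFinrankEq _ _ (by rw [h₀, Module.finrank_self])
  let e₁ : V.V₁ ≃ₗ[ℂ] ℂ := LinearEquiv.ofFinrankEq _ _ (by rw [h₁, Module.finrank_self])
  have r₀ (x) : x = e₀ x • e₀.symm 1 := by
    rw [← map_smul, smul_eq_mul, mul_one, e₀.symm_apply_apply]
  have r₁ (x) : x = e₁ x • e₁.symm 1 := by
    rw [← map_smul, smul_eq_mul, mul_one, e₁.symm_apply_apply]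
  have ha (i x) : e₁ (V.a i x) = e₁ (V.a i (e₀.symm 1)) * e₀ x := by
    conv_lhs => rw [r₀ x, map_smul, map_smul]
    exact mul_comm _ _
  have hb (i x) : e₀ (V.b i x) = e₀ (V.b i (e₁.symm 1)) * e₁ x := by
    conv_lhs => rw [r₁ x, map_smul, map_smul]
    exact mul_comm _ _
  refine ⟨⟨fun i => e₀ (V.b i (e₁.symm 1)), fun i => e₁ (V.a i (e₀.symm 1)), t, fun hs => ?_⟩,
    Isomorphic.symm ⟨⟨e₀.toLinearMap, e₁.toLinearMap, ha, hb, fun x => ?_, fun x => ?_⟩,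
      e₀.bijective, e₁.bijective⟩⟩
  · have hb0 (i x) : V.b i x = 0 := by
      refine e₀.injective ((hb i x).trans ?_)
      rw [show e₀ (V.b i (e₁.symm 1)) = 0 from congrFun hs i, zero_mul, map_zero]
    let W : V.Sub :=
      { W₀ := ⊥
        W₁ := ⊤
        a_mem := fun _ _ _ => trivial
        b_mem := fun i x _ => hb0 i x
        c_mem := fun x hx => by rw [(Submodule.mem_bot ℂ).1 hx, map_zero]; exact zero_mem _
        d_mem := fun _ _ => trivial }
    have k₀ : Module.finrank ℂ W.W₀ = 0 := finrank_bot _ _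
    have k₁ : Module.finrank ℂ W.W₁ = 1 := finrank_top _ _ |>.trans h₁
    have := hV W (fun h => by rw [h.2, finrank_bot] at k₁; omega)
      (fun h => by rw [h.1, finrank_top] at k₀; omega)
    rw [k₀, k₁, h₀] at this
    omega
  · exact (congrArg e₀ (ht.1 x)).trans (map_smul e₀ t x)
  · exact (congrArg e₁ (ht.2 x)).trans (map_smul e₁ t x)

/-- The classification of stable representations for `θ₀ < θ₁`. -/
theorem negStable_iff {V : QuiverRep.{u}} (hf : V.IsFinite) (hz : ¬ V.IsZero) : V.NegStable ↔
    (∃ t n, (preprojective t n).Isomorphic V) ∨ (∃ t n, (preinjective t n).Isomorphic V) ∨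
      ∃ x : HPoint, (point x.s x.w x.t).Isomorphic V := by
  -- An arbitrary parameter with `θ₀ < θ₁`: invariance under isomorphism is available for
  -- `IsStable`, so `NegStable` is transported through it.
  have h01 : ((0 : ℝ), (1 : ℝ)).1 < ((0 : ℝ), (1 : ℝ)).2 := zero_lt_one
  constructor
  · intro hV
    obtain ⟨t, ht⟩ := hV.exists_loopsEq hf hz
    by_cases h11 : Module.finrank ℂ V.V₀ = 1 ∧ Module.finrank ℂ V.V₁ = 1
    · exact .inr (.inr (hV.exists_point hf h11.1 h11.2 ht))
    have hk : V.IsKronecker t := ⟨hV.a_eq_zero hf hz h11, ht⟩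
    obtain ⟨h, h'⟩ := hV.finrank_le hf hz hk
    rcases lt_trichotomy (Module.finrank ℂ V.V₀) (Module.finrank ℂ V.V₁) with hlt | heq | hlt
    · refine .inr (.inl ⟨t, Module.finrank ℂ V.V₀, (negStable_preinjective t _).isomorphic_of_finrank_eq
        hV (isFinite_preinjective t _) hf ?_ ?_ ?_ (isKronecker_preinjective t _) hk⟩)
      · exact Module.finrank_fin_fun ℂ
      · exact (Module.finrank_fin_fun ℂ).trans (by omega)
      · exact ne_of_eq_of_ne (Module.finrank_fin_fun ℂ)
          (ne_of_ne_of_eq (by omega) (Module.finrank_fin_fun ℂ).symm)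
    · have := hV.finrank_eq_one hf hz hk heq
      exact absurd ⟨heq.trans this, this⟩ h11
    · refine .inl ⟨t, Module.finrank ℂ V.V₁, (negStable_preprojective t _).isomorphic_of_finrank_eq
        hV (isFinite_preprojective t _) hf ?_ ?_ ?_ (isKronecker_preprojective t _) hk⟩
      · exact (finrank_degreeLT _).trans (by omega)
      · exact finrank_degreeLT _
      · exact ne_of_eq_of_ne (finrank_degreeLT _) (ne_of_ne_of_eq (by omega) (finrank_degreeLT _).symm)
  · rintro (⟨t, n, h⟩ | ⟨t, n, h⟩ | ⟨x, h⟩) <;> rw [← isStable_iff_negStable hf h01] <;>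
      refine h.isStable ((isStable_iff_negStable ?_ h01).2 ?_)
    · exact isFinite_preprojective t n
    · exact negStable_preprojective t n
    · exact isFinite_preinjective t n
    · exact negStable_preinjective t n
    · exact isFinite_point _ _ _
    · exact negStable_point x.s_ne _ _

end QuiverRep

/-! ### Reading off the cohomology of two-term complexes of representations. -/

theorem represents_iff {C₀ C₁ : QuiverRep.{u}} {φ : C₀.Hom C₁} {M : QuiverRep.{v}}
    {V : QuiverRep.{w}} (hk : φ.ker.Isomorphic M) (hc : φ.coker.IsZero) :
    Represents φ V ↔ M.Isomorphic V :=
  ⟨fun h => hk.symm.trans h.1, fun h => ⟨hk.trans h, hc⟩⟩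

theorem shiftRepresents_iff {C₀ C₁ : QuiverRep.{u}} {φ : C₀.Hom C₁} {M : QuiverRep.{v}}
    {V : QuiverRep.{w}} (hc : φ.coker.Isomorphic M) (hk : φ.ker.IsZero) :
    ShiftRepresents φ V ↔ M.Isomorphic V :=
  ⟨fun h => hc.symm.trans h.1, fun h => ⟨hc.trans h, hk⟩⟩

theorem QuiverRep.Hom.isZero_ker {C₀ C₁ : QuiverRep.{u}} (φ : C₀.Hom C₁)
    (h₀ : ∀ x, φ.f₀ x = 0 → x = 0) (h₁ : ∀ x, φ.f₁ x = 0 → x = 0) : φ.ker.IsZero :=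
  ⟨⟨fun x y => Subtype.ext ((h₀ _ x.2).trans (h₀ _ y.2).symm)⟩,
    ⟨fun x y => Subtype.ext ((h₁ _ x.2).trans (h₁ _ y.2).symm)⟩⟩

theorem QuiverRep.Hom.isZero_coker {C₀ C₁ : QuiverRep.{u}} (φ : C₀.Hom C₁)
    (h₀ : Function.Surjective φ.f₀) (h₁ : Function.Surjective φ.f₁) : φ.coker.IsZero :=
  ⟨Submodule.Quotient.subsingleton_iff.2 (LinearMap.range_eq_top.2 h₀),
    Submodule.Quotient.subsingleton_iff.2 (LinearMap.range_eq_top.2 h₁)⟩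

theorem sSec_f₀ (i : Fin 2) : (sSec i).f₀ = MvPolynomial.X 0 ^ (i : ℕ) := by
  fin_cases i <;> simp [sSec]

/-! ### Cohomology of line bundles on the projective line -/

/-- The Čech differential of `𝒪(k)` on `ℙ¹`. -/
def cechP1 (k : ℤ) : (ℂ[X] × ℂ[X]) →ₗ[ℂ] ℂ[T;T⁻¹] :=
  Polynomial.toLaurentAlg.toLinearMap.comp (LinearMap.fst ℂ _ _) -
    (LinearMap.mulLeft ℂ (LaurentPolynomial.T k)).comp
      (LaurentPolynomial.invert.toLinearMap.comp
        (Polynomial.toLaurentAlg.toLinearMap.comp (LinearMap.snd ℂ _ _)))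

theorem cechP1_apply (k : ℤ) (p q : ℂ[X]) : cechP1 k (p, q) =
    Polynomial.toLaurent p - LaurentPolynomial.T k * LaurentPolynomial.invert (Polynomial.toLaurent q) :=
  rfl

theorem coeff_toLaurent_eq (p : ℂ[X]) (j : ℤ) :
    (Polynomial.toLaurent p).coeff j = if 0 ≤ j then p.coeff j.toNat else 0 := by
  induction p using Polynomial.induction_on' with
  | add p q hp hq =>
    rw [map_add, AddMonoidAlgebra.coeff_add, Finsupp.add_apply, hp, hq]
    split_ifs <;> simp
  | monomial n a =>
    rw [← Polynomial.C_mul_X_pow_eq_monomial, Polynomial.toLaurent_C_mul_X_pow,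
      ← LaurentPolynomial.single_eq_C_mul_T, Polynomial.coeff_C_mul_X_pow]
    change Finsupp.single (n : ℤ) a j = _
    rw [Finsupp.single_apply]
    split_ifs <;> first | rfl | omega

theorem coeff_T_mul (k : ℤ) (p : ℂ[T;T⁻¹]) (j : ℤ) :
    (LaurentPolynomial.T k * p).coeff j = p.coeff (j - k) := by
  have := AddMonoidAlgebra.coeff_single_mul_add p 1 k (j - k)
  rwa [add_sub_cancel, one_mul] at this

/-- The cohomology of `𝒪(k)` is read off from this formula. A degree `j` is reached from both charts
if `0 ≤ j ≤ k`, which gives `H⁰`, and from neither if `k < j < 0`, which gives `H¹`. -/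
theorem coeff_cechP1 (k : ℤ) (p q : ℂ[X]) (j : ℤ) : (cechP1 k (p, q)).coeff j =
    (if 0 ≤ j then p.coeff j.toNat else 0) - if j ≤ k then q.coeff (k - j).toNat else 0 := by
  rw [cechP1_apply, AddMonoidAlgebra.coeff_sub, Finsupp.sub_apply, coeff_T_mul,
    LaurentPolynomial.invert_apply, coeff_toLaurent_eq, coeff_toLaurent_eq, neg_sub]
  simp only [sub_nonneg]

theorem coe_pullOverlap_z_zpow (a : ℂ) (n : ℤ) :
    P1.pullOverlap a ((z ^ n : Overlapˣ) : Overlap) = LaurentPolynomial.T n := by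
  have hz (m : ℕ) : P1.pullOverlap a ((z ^ m : Overlapˣ) : Overlap) = LaurentPolynomial.T m := by
    rw [Units.val_pow_eq_pow_val, map_pow, P1.pullOverlap_z, LaurentPolynomial.T_pow, mul_one]
  obtain ⟨m, rfl | rfl⟩ := n.eq_nat_or_neg
  · rw [zpow_natCast, hz]
  · rw [zpow_neg, zpow_natCast, ← inv_pow, Units.val_pow_eq_pow_val, map_pow, P1.pullOverlap_z_inv,
      LaurentPolynomial.T_pow, mul_neg_one]

/-- The twist multiplies the transition function `T k` by the restriction of `zⁿ` to the curve,
which is `T n`. -/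
theorem cech_twist_lineSheaf (a : ℂ) (k n : ℤ) (x : ℂ[X] × ℂ[X]) :
    ((lineSheaf a k).twist n).cech x = cechP1 (k + n) x := by
  change Polynomial.toLaurent x.1 - P1.pullOverlap a ((z ^ n : Overlapˣ) : Overlap) *
    (LaurentPolynomial.T k * LaurentPolynomial.invert (Polynomial.toLaurent x.2)) = _
  rw [coe_pullOverlap_z_zpow, ← mul_assoc, ← LaurentPolynomial.T_add, add_comm n]
  rfl

theorem mem_degreeLT_of_cechP1_eq_zero {k : ℤ} {m : ℕ} (hk : k < m) {p q : ℂ[X]}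
    (h : cechP1 k (p, q) = 0) : p ∈ Polynomial.degreeLT ℂ m := by
  rw [Polynomial.mem_degreeLT, Polynomial.degree_lt_iff_coeff_zero]
  intro i hi
  have := coeff_cechP1 k p q i
  rw [h, if_pos (by omega), if_neg (by omega), sub_zero] at this
  exact this.symm

theorem fst_eq_zero_of_cechP1_eq_zero {k : ℤ} (hk : k < 0) {p q : ℂ[X]}
    (h : cechP1 k (p, q) = 0) : p = 0 := by
  have := mem_degreeLT_of_cechP1_eq_zero (m := 0) hk h
  rw [Polynomial.mem_degreeLT, Polynomial.degree_lt_iff_coeff_zero] at this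
  exact Polynomial.ext fun i => this i (Nat.zero_le i)

theorem snd_eq_zero_of_cechP1_eq_zero {k : ℤ} {q : ℂ[X]} (h : cechP1 k (0, q) = 0) : q = 0 := by
  ext i
  have := coeff_cechP1 k 0 q (k - i)
  rw [h, if_pos (c := k - (i : ℤ) ≤ k) (by omega), sub_sub_cancel, Int.toNat_natCast] at this
  simpa using this

theorem cechP1_injective {k : ℤ} (hk : k < 0) {x : ℂ[X] × ℂ[X]} (h : cechP1 k x = 0) : x = 0 := by
  obtain ⟨p, q⟩ := x
  obtain rfl := fst_eq_zero_of_cechP1_eq_zero hk h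
  obtain rfl := snd_eq_zero_of_cechP1_eq_zero h
  rfl

theorem exists_cechP1_eq_zero {k : ℤ} {m : ℕ} (hk : k + 1 = m) {p : ℂ[X]}
    (hp : p ∈ Polynomial.degreeLT ℂ m) : ∃ q, cechP1 k (p, q) = 0 := by
  rw [Polynomial.mem_degreeLT, Polynomial.degree_lt_iff_coeff_zero] at hp
  -- The section in the other coordinate is `p` with its coefficients reversed with respect to
  -- degree `k = m - 1`.
  refine ⟨Polynomial.reflect (m - 1) p, LaurentPolynomial.ext fun j => ?_⟩
  rw [coeff_cechP1]
  change _ = (0 : ℂ)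
  by_cases h0 : 0 ≤ j
  · by_cases h1 : j ≤ k
    · rw [if_pos h0, if_pos h1, Polynomial.coeff_reflect, Polynomial.revAt_le (by omega), sub_eq_zero]
      congr 1
      omega
    · rw [if_pos h0, if_neg h1, sub_zero, hp _ (by omega)]
  · rw [if_neg h0, zero_sub, neg_eq_zero]
    split_ifs with h1
    · rw [Polynomial.coeff_reflect]
      refine hp _ ?_
      -- For `m = 0` the truncated `m - 1` is not `k = -1`, but then `p` has no non-zero coefficient
      -- at all.
      rcases Nat.eq_zero_or_pos m with rfl | hm
      · exact Nat.zero_le _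
      · have : m - 1 < (k - j).toNat := by omega
        rw [Polynomial.revAt_eq_self_of_lt this]
        omega
    · rfl

/-- Monomial by monomial: `T j` comes from the first chart if `j ≥ 0` and from the second if `j ≤
k`. -/
theorem mem_range_cechP1 {k : ℤ} {p : ℂ[T;T⁻¹]} (h : ∀ j, k < j → j < 0 → p.coeff j = 0) :
    p ∈ LinearMap.range (cechP1 k) := by
  rw [← AddMonoidAlgebra.sum_coeff_single p]
  refine Submodule.sum_mem _ fun j hj => ?_
  rw [LaurentPolynomial.single_eq_C_mul_T]
  rcases le_or_gt 0 j with h0 | h0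
  · obtain ⟨n, rfl⟩ := Int.eq_ofNat_of_zero_le h0
    refine ⟨(Polynomial.C (p.coeff n) * Polynomial.X ^ n, 0), ?_⟩
    rw [cechP1_apply, map_zero, map_zero, mul_zero, sub_zero, Polynomial.toLaurent_C_mul_X_pow]
  · have hk : j ≤ k := by
      by_contra! hk
      exact Finsupp.mem_support_iff.1 hj (h j hk h0)
    obtain ⟨n, hn⟩ := Int.eq_ofNat_of_zero_le (sub_nonneg.2 hk)
    refine ⟨(0, -(Polynomial.C (p.coeff j) * Polynomial.X ^ n)), ?_⟩
    rw [cechP1_apply, map_zero, map_neg, map_neg, mul_neg, zero_sub, neg_neg,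
      Polynomial.toLaurent_C_mul_X_pow, map_mul, LaurentPolynomial.invert_C,
      LaurentPolynomial.invert_T, mul_left_comm, ← LaurentPolynomial.T_add]
    congr 2
    omega

theorem cechP1_surjective {k : ℤ} (hk : -1 ≤ k) : Function.Surjective (cechP1 k) :=
  fun _ => mem_range_cechP1 fun _ _ _ => by omega

/-- The coefficients of `T⁻¹, …, T⁻ᵐ`. -/
def polarCoeff (m : ℕ) : ℂ[T;T⁻¹] →ₗ[ℂ] (Fin m → ℂ) where
  toFun p i := p.coeff (-1 - (i : ℕ))
  map_add' _ _ := rfl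
  map_smul' _ _ := rfl

/-- For `k = -m - 1` the gap `k < j < 0` consists of `-1, …, -m`, so `polarCoeff m` gives
coordinates on `H¹(𝒪(k))`. -/
theorem range_cechP1 {k : ℤ} {m : ℕ} (hk : k + 1 = -m) :
    LinearMap.range (cechP1 k) = LinearMap.ker (polarCoeff m) := by
  refine le_antisymm ?_ fun p hp => mem_range_cechP1 fun j h h0 => ?_
  · rintro _ ⟨⟨p, q⟩, rfl⟩
    refine funext fun i => ?_
    change (cechP1 k (p, q)).coeff _ = 0
    rw [coeff_cechP1, if_neg (by omega), if_neg (by omega), sub_zero]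
  · have := congrFun (LinearMap.mem_ker.1 hp) ⟨(-1 - j).toNat, by omega⟩
    change p.coeff (-1 - ((-1 - j).toNat : ℤ)) = 0 at this
    rwa [show -1 - ((-1 - j).toNat : ℤ) = j by omega] at this

theorem polarCoeff_surjective (m : ℕ) : Function.Surjective (polarCoeff m) := by
  intro x
  refine ⟨∑ i : Fin m, AddMonoidAlgebra.single (-1 - ((i : ℕ) : ℤ)) (x i), funext fun i => ?_⟩
  change (∑ i : Fin m, AddMonoidAlgebra.single (-1 - ((i : ℕ) : ℤ)) (x i)).coeff _ = _
  rw [AddMonoidAlgebra.coeff_sum, Finsupp.finsetSum_apply, Finset.sum_eq_single i]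
  · exact Finsupp.single_eq_same
  · intro j _ hj
    refine Finsupp.single_eq_of_ne fun h => hj (Fin.ext ?_)
    omega
  · exact fun h => (h (Finset.mem_univ i)).elim

namespace QuiverRep

variable {C₀ C₁ : QuiverRep.{u}} {M : QuiverRep.{v}}

/-- A criterion for the kernel of a morphism to be isomorphic to `M`, where kernel and `M` are
compared in larger spaces. -/
theorem Hom.ker_isomorphic (φ : C₀.Hom C₁) {P₀ P₁ : Type w} [AddCommGroup P₀] [AddCommGroup P₁]
    [Module ℂ P₀] [Module ℂ P₁] (e₀ : C₀.V₀ →ₗ[ℂ] P₀) (e₁ : C₀.V₁ →ₗ[ℂ] P₁)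
    (ι₀ : M.V₀ →ₗ[ℂ] P₀) (ι₁ : M.V₁ →ₗ[ℂ] P₁)
    (hι₀ : Function.Injective ι₀) (hι₁ : Function.Injective ι₁)
    (inj₀ : ∀ x, φ.f₀ x = 0 → e₀ x = 0 → x = 0) (inj₁ : ∀ x, φ.f₁ x = 0 → e₁ x = 0 → x = 0)
    (surj₀ : ∀ y, ∃ x, φ.f₀ x = 0 ∧ e₀ x = ι₀ y) (surj₁ : ∀ y, ∃ x, φ.f₁ x = 0 ∧ e₁ x = ι₁ y)
    (mem₀ : ∀ x, φ.f₀ x = 0 → ∃ y, ι₀ y = e₀ x) (mem₁ : ∀ x, φ.f₁ x = 0 → ∃ y, ι₁ y = e₁ x)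
    (ha : ∀ i x y, e₀ x = ι₀ y → e₁ (C₀.a i x) = ι₁ (M.a i y))
    (hb : ∀ i x y, e₁ x = ι₁ y → e₀ (C₀.b i x) = ι₀ (M.b i y))
    (hc : ∀ x y, e₀ x = ι₀ y → e₀ (C₀.c x) = ι₀ (M.c y))
    (hd : ∀ x y, e₁ x = ι₁ y → e₁ (C₀.d x) = ι₁ (M.d y)) : φ.ker.Isomorphic M := by
  choose s₀ hs₀ he₀ using surj₀
  choose s₁ hs₁ he₁ using surj₁
  -- A cocycle is determined by its image under `e₀`. Hence the chosen lifts of `ι₀ y` depend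
  -- linearly on `y` and commute with the arrows.
  have u₀ {x y} (hx : φ.f₀ x = 0) (hy : φ.f₀ y = 0) (h : e₀ x = e₀ y) : x = y :=
    sub_eq_zero.1 (inj₀ _ (by rw [map_sub, hx, hy, sub_zero]) (by rw [map_sub, h, sub_self]))
  have u₁ {x y} (hx : φ.f₁ x = 0) (hy : φ.f₁ y = 0) (h : e₁ x = e₁ y) : x = y :=
    sub_eq_zero.1 (inj₁ _ (by rw [map_sub, hx, hy, sub_zero]) (by rw [map_sub, h, sub_self]))
  let f₀ : M.V₀ →ₗ[ℂ] LinearMap.ker φ.f₀ :=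
    { toFun := fun y => ⟨s₀ y, hs₀ y⟩
      map_add' := fun x y => Subtype.ext (u₀ (hs₀ _)
        (Submodule.add_mem (LinearMap.ker φ.f₀) (hs₀ x) (hs₀ y))
        ((he₀ _).trans ((map_add ι₀ x y).trans ((congrArg₂ (· + ·) (he₀ x) (he₀ y)).symm.trans
          (map_add e₀ _ _).symm))))
      map_smul' := fun r y => Subtype.ext (u₀ (hs₀ _)
        (Submodule.smul_mem (LinearMap.ker φ.f₀) r (hs₀ y))
        ((he₀ _).trans ((map_smul ι₀ r y).trans ((congrArg (r • ·) (he₀ y)).symm.trans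
          (map_smul e₀ r _).symm)))) }
  let f₁ : M.V₁ →ₗ[ℂ] LinearMap.ker φ.f₁ :=
    { toFun := fun y => ⟨s₁ y, hs₁ y⟩
      map_add' := fun x y => Subtype.ext (u₁ (hs₁ _)
        (Submodule.add_mem (LinearMap.ker φ.f₁) (hs₁ x) (hs₁ y))
        ((he₁ _).trans ((map_add ι₁ x y).trans ((congrArg₂ (· + ·) (he₁ x) (he₁ y)).symm.trans
          (map_add e₁ _ _).symm))))
      map_smul' := fun r y => Subtype.ext (u₁ (hs₁ _)
        (Submodule.smul_mem (LinearMap.ker φ.f₁) r (hs₁ y))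
        ((he₁ _).trans ((map_smul ι₁ r y).trans ((congrArg (r • ·) (he₁ y)).symm.trans
          (map_smul e₁ r _).symm)))) }
  refine Isomorphic.symm ⟨⟨f₀, f₁, fun i y => ?_, fun i y => ?_, fun y => ?_, fun y => ?_⟩,
    ⟨fun x y h => ?_, fun x => ?_⟩, ⟨fun x y h => ?_, fun x => ?_⟩⟩
  · refine Subtype.ext (u₁ (hs₁ _) (φ.ker.a i (f₀ y)).2 ?_)
    exact (he₁ _).trans (ha i _ y (he₀ y)).symm
  · refine Subtype.ext (u₀ (hs₀ _) (φ.ker.b i (f₁ y)).2 ?_)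
    exact (he₀ _).trans (hb i _ y (he₁ y)).symm
  · refine Subtype.ext (u₀ (hs₀ _) (φ.ker.c (f₀ y)).2 ?_)
    exact (he₀ _).trans (hc _ y (he₀ y)).symm
  · refine Subtype.ext (u₁ (hs₁ _) (φ.ker.d (f₁ y)).2 ?_)
    exact (he₁ _).trans (hd _ y (he₁ y)).symm
  · exact hι₀ (by rw [← he₀, ← he₀]; exact congrArg (fun z => e₀ (Subtype.val z)) h)
  · obtain ⟨y, hy⟩ := mem₀ x.1 x.2
    exact ⟨y, Subtype.ext (u₀ (hs₀ y) x.2 ((he₀ y).trans hy))⟩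
  · exact hι₁ (by rw [← he₁, ← he₁]; exact congrArg (fun z => e₁ (Subtype.val z)) h)
  · obtain ⟨y, hy⟩ := mem₁ x.1 x.2
    exact ⟨y, Subtype.ext (u₁ (hs₁ y) x.2 ((he₁ y).trans hy))⟩

/-- A criterion for the cokernel of a morphism to be isomorphic to `M`. -/
theorem Hom.coker_isomorphic (φ : C₀.Hom C₁) (ψ : C₁.Hom M)
    (surj₀ : Function.Surjective ψ.f₀) (surj₁ : Function.Surjective ψ.f₁)
    (h₀ : LinearMap.range φ.f₀ = LinearMap.ker ψ.f₀)
    (h₁ : LinearMap.range φ.f₁ = LinearMap.ker ψ.f₁) : φ.coker.Isomorphic M := by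
  refine ⟨⟨(LinearMap.range φ.f₀).liftQ ψ.f₀ h₀.le, (LinearMap.range φ.f₁).liftQ ψ.f₁ h₁.le,
    fun i x => ?_, fun i x => ?_, fun x => ?_, fun x => ?_⟩, ⟨?_, ?_⟩, ⟨?_, ?_⟩⟩
  · obtain ⟨x, rfl⟩ := Submodule.Quotient.mk_surjective _ x
    exact ψ.comm_a i x
  · obtain ⟨x, rfl⟩ := Submodule.Quotient.mk_surjective _ x
    exact ψ.comm_b i x
  · obtain ⟨x, rfl⟩ := Submodule.Quotient.mk_surjective _ x
    exact ψ.comm_c x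
  · obtain ⟨x, rfl⟩ := Submodule.Quotient.mk_surjective _ x
    exact ψ.comm_d x
  · exact LinearMap.ker_eq_bot.1 (Submodule.ker_liftQ_eq_bot _ _ _ h₀.ge)
  · exact fun y => (surj₀ y).imp' (Submodule.Quotient.mk) fun _ h => h
  · exact LinearMap.ker_eq_bot.1 (Submodule.ker_liftQ_eq_bot _ _ _ h₁.ge)
  · exact fun y => (surj₁ y).imp' (Submodule.Quotient.mk) fun _ h => h

end QuiverRep

/-! ### The two functors on line bundles on the curves. -/

theorem fst_mul₀_lineSheaf (a : ℂ) (k : ℤ) {l : ℤ} (σ : LineSection l) (x : ℂ[X] × ℂ[X]) :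
    ((lineSheaf a k).mul₀ σ x).1 = P1.pull a σ.f₀ * x.1 :=
  rfl

theorem mul₁_lineSheaf (a : ℂ) (k : ℤ) {l : ℤ} (σ : LineSection l) (x : ℂ[T;T⁻¹]) :
    (lineSheaf a k).mul₁ σ x = Polynomial.toLaurent (P1.pull a σ.f₀) * x := by
  rw [← P1.pullOverlap_fromU₀]
  rfl

theorem pull_sSec (a : ℂ) (i : Fin 2) : P1.pull a (sSec i).f₀ = Polynomial.X ^ (i : ℕ) := by
  rw [sSec_f₀, map_pow, P1.pull, MvPolynomial.aeval_X]
  rfl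

theorem pull_wSec (a : ℂ) (i : Fin 2) : P1.pull a (wSec i).f₀ = 0 := by
  fin_cases i <;> exact MvPolynomial.aeval_X _ _

theorem pull_tSec (a : ℂ) : P1.pull a tSec.f₀ = Polynomial.C a :=
  MvPolynomial.aeval_X _ _

open QuiverRep

theorem eq_zero_of_cechP1_eq_zero {k : ℤ} {x : ℂ[X] × ℂ[X]} (h : cechP1 k x = 0) (hx : x.1 = 0) :
    x = 0 := by
  obtain ⟨p, q⟩ := x
  obtain rfl : p = 0 := hx
  obtain rfl := snd_eq_zero_of_cechP1_eq_zero h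
  rfl

/-- Vertex `0` carries `H⁰(𝒪(n))` and vertex `1`, twisted by `-1`, carries `H⁰(𝒪(n - 1))`. The first
Čech component identifies them with polynomials of degree less than `n + 1` and less than `n`. On
the curve the `sᵢ` become `1` and `X`, the `wᵢ` vanish, and `t` is the constant `a`. -/
theorem ker_Φ₀_lineSheaf (a : ℂ) {k : ℤ} {n : ℕ} (hk : k = n) :
    (lineSheaf a k).Φ₀.ker.Isomorphic (preprojective a n) := by
  have h₀ := cech_twist_lineSheaf a k 0
  have h₁ := cech_twist_lineSheaf a k (-1)
  refine Hom.ker_isomorphic (P₀ := ℂ[X]) (P₁ := ℂ[X]) _ (LinearMap.fst ℂ ℂ[X] ℂ[X])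
    (LinearMap.fst ℂ ℂ[X] ℂ[X]) (Polynomial.degreeLT ℂ (n + 1)).subtype
    (Polynomial.degreeLT ℂ n).subtype Subtype.val_injective Subtype.val_injective
    (fun x hx h => eq_zero_of_cechP1_eq_zero ((h₀ x).symm.trans hx) h)
    (fun x hx h => eq_zero_of_cechP1_eq_zero ((h₁ x).symm.trans hx) h)
    (fun y => ?_) (fun y => ?_)
    (fun x hx => ⟨⟨_, mem_degreeLT_of_cechP1_eq_zero (by omega) ((h₀ x).symm.trans hx)⟩, rfl⟩)
    (fun x hx => ⟨⟨_, mem_degreeLT_of_cechP1_eq_zero (by omega) ((h₁ x).symm.trans hx)⟩, rfl⟩)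
    ?_ ?_ ?_ ?_
  · obtain ⟨q, hq⟩ := exists_cechP1_eq_zero (k := k + 0) (by omega) y.2
    exact ⟨(y.1, q), (h₀ _).trans hq, rfl⟩
  · obtain ⟨q, hq⟩ := exists_cechP1_eq_zero (k := k + (-1)) (by omega) y.2
    exact ⟨(y.1, q), (h₁ _).trans hq, rfl⟩
  · rintro i x y -
    refine (fst_mul₀_lineSheaf a k (wSec i) x).trans ?_
    rw [pull_wSec, zero_mul]; rfl
  · rintro i x y h
    refine (fst_mul₀_lineSheaf a k (sSec i) x).trans ?_
    rw [pull_sSec]; exact congrArg _ h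
  · rintro x y h
    refine (fst_mul₀_lineSheaf a k tSec x).trans ?_
    rw [pull_tSec, ← Polynomial.smul_eq_C_mul]; exact congrArg _ h
  · rintro x y h
    refine (fst_mul₀_lineSheaf a k tSec x).trans ?_
    rw [pull_tSec, ← Polynomial.smul_eq_C_mul]; exact congrArg _ h

/-- On the flop the twist is by `+1` and the arrows `aᵢ` are the base coordinates, so the larger
space of sections, that of `𝒪(n)`, sits at vertex `1`. -/
theorem ker_Φ₀plus_lineSheaf (a : ℂ) {k : ℤ} {n : ℕ} (hk : k + 1 = n) :
    (lineSheaf a k).Φ₀plus.ker.Isomorphic (preprojective a n).swap := by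
  have h₀ := cech_twist_lineSheaf a k 0
  have h₁ := cech_twist_lineSheaf a k 1
  refine Hom.ker_isomorphic (P₀ := ℂ[X]) (P₁ := ℂ[X]) _ (LinearMap.fst ℂ ℂ[X] ℂ[X])
    (LinearMap.fst ℂ ℂ[X] ℂ[X]) (Polynomial.degreeLT ℂ n).subtype
    (Polynomial.degreeLT ℂ (n + 1)).subtype Subtype.val_injective Subtype.val_injective
    (fun x hx h => eq_zero_of_cechP1_eq_zero ((h₀ x).symm.trans hx) h)
    (fun x hx h => eq_zero_of_cechP1_eq_zero ((h₁ x).symm.trans hx) h)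
    (fun y => ?_) (fun y => ?_)
    (fun x hx => ⟨⟨_, mem_degreeLT_of_cechP1_eq_zero (by omega) ((h₀ x).symm.trans hx)⟩, rfl⟩)
    (fun x hx => ⟨⟨_, mem_degreeLT_of_cechP1_eq_zero (by omega) ((h₁ x).symm.trans hx)⟩, rfl⟩)
    ?_ ?_ ?_ ?_
  · obtain ⟨q, hq⟩ := exists_cechP1_eq_zero (k := k + 0) (by omega) y.2
    exact ⟨(y.1, q), (h₀ _).trans hq, rfl⟩
  · obtain ⟨q, hq⟩ := exists_cechP1_eq_zero (k := k + 1) (by omega) y.2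
    exact ⟨(y.1, q), (h₁ _).trans hq, rfl⟩
  · rintro i x y h
    refine (fst_mul₀_lineSheaf a k (sSec i) x).trans ?_
    rw [pull_sSec]; exact congrArg _ h
  · rintro i x y -
    refine (fst_mul₀_lineSheaf a k (wSec i) x).trans ?_
    rw [pull_wSec, zero_mul]; rfl
  · rintro x y h
    refine (fst_mul₀_lineSheaf a k tSec x).trans ?_
    rw [pull_tSec, ← Polynomial.smul_eq_C_mul]; exact congrArg _ h
  · rintro x y h
    refine (fst_mul₀_lineSheaf a k tSec x).trans ?_
    rw [pull_tSec, ← Polynomial.smul_eq_C_mul]; exact congrArg _ h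

/-- The coefficient of `Tⁱ p` in degree `-1 - j` is that of `p` in degree `-1 - (j + i)`:
multiplication by `1` keeps the first `m` of the `m + 1` polar coefficients, multiplication by `T`
the last `m`. -/
theorem polarCoeff_mul₁_sSec (a : ℂ) (k : ℤ) (m : ℕ) (i : Fin 2) (p : ℂ[T;T⁻¹]) :
    polarCoeff m ((lineSheaf a k).mul₁ (sSec i) p) =
      LinearMap.funLeft ℂ ℂ (![Fin.castSucc, Fin.succ] i) (polarCoeff (m + 1) p) := by
  rw [mul₁_lineSheaf, pull_sSec, Polynomial.toLaurent_X_pow]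
  funext j
  change AddMonoidAlgebra.coeff (_ * _) _ = AddMonoidAlgebra.coeff _ _
  rw [coeff_T_mul]
  congr 1
  fin_cases i
  · simp
  · simp; ring

theorem polarCoeff_mul₁_wSec (a : ℂ) (k : ℤ) (m : ℕ) (i : Fin 2) (p : ℂ[T;T⁻¹]) :
    polarCoeff m ((lineSheaf a k).mul₁ (wSec i) p) = 0 := by
  rw [mul₁_lineSheaf, pull_wSec, map_zero, zero_mul, map_zero]

theorem polarCoeff_mul₁_tSec (a : ℂ) (k : ℤ) (m : ℕ) (p : ℂ[T;T⁻¹]) :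
    polarCoeff m ((lineSheaf a k).mul₁ tSec p) = a • polarCoeff m p := by
  rw [mul₁_lineSheaf, pull_tSec, Polynomial.toLaurent_C, ← LaurentPolynomial.smul_eq_C_mul, map_smul]

/-- Here `k = -n - 1`, so `H¹` has dimension `n` at vertex `0` and, after the twist by `-1`,
dimension `n + 1` at vertex `1`. -/
theorem coker_Φ₀_lineSheaf (a : ℂ) {k : ℤ} {n : ℕ} (hk : k + 1 = -n) :
    (lineSheaf a k).Φ₀.coker.Isomorphic (preinjective a n) := by
  refine Hom.coker_isomorphic _ ⟨polarCoeff n, polarCoeff (n + 1), fun i x => ?_, fun i x => ?_,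
    fun x => ?_, fun x => ?_⟩ (polarCoeff_surjective _) (polarCoeff_surjective _) ?_ ?_
  · exact polarCoeff_mul₁_wSec a k _ i x
  · exact polarCoeff_mul₁_sSec a k _ i x
  · exact polarCoeff_mul₁_tSec a k _ x
  · exact polarCoeff_mul₁_tSec a k _ x
  · refine Eq.trans (congrArg LinearMap.range (LinearMap.ext (cech_twist_lineSheaf a k 0))) ?_
    exact range_cechP1 (by omega)
  · refine Eq.trans (congrArg LinearMap.range (LinearMap.ext (cech_twist_lineSheaf a k (-1)))) ?_
    exact range_cechP1 (by omega)

theorem coker_Φ₀plus_lineSheaf (a : ℂ) {k : ℤ} {n : ℕ} (hk : k + 1 = -(n + 1 : ℕ)) :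
    (lineSheaf a k).Φ₀plus.coker.Isomorphic (preinjective a n).swap := by
  refine Hom.coker_isomorphic _ ⟨polarCoeff (n + 1), polarCoeff n, fun i x => ?_, fun i x => ?_,
    fun x => ?_, fun x => ?_⟩ (polarCoeff_surjective _) (polarCoeff_surjective _) ?_ ?_
  · exact polarCoeff_mul₁_sSec a k _ i x
  · exact polarCoeff_mul₁_wSec a k _ i x
  · exact polarCoeff_mul₁_tSec a k _ x
  · exact polarCoeff_mul₁_tSec a k _ x
  · refine Eq.trans (congrArg LinearMap.range (LinearMap.ext (cech_twist_lineSheaf a k 0))) ?_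
    exact range_cechP1 (by omega)
  · refine Eq.trans (congrArg LinearMap.range (LinearMap.ext (cech_twist_lineSheaf a k 1))) ?_
    exact range_cechP1 (by omega)

/-- The degrees at the two vertices are `n` and `n - 1`, both at least `-1`, so `H¹` vanishes. The
parameter `m = n + 1` gives dimension `(m, m - 1)`; for `m = 0` the degree at vertex `1` would be
`-2`, with `H¹ ≠ 0`. -/
theorem typeI_iff {V : QuiverRep.{u}} {a : ℂ} {n : ℕ} :
    V.TypeI a (n + 1) ↔ (preprojective a n).Isomorphic V := by
  refine represents_iff (ker_Φ₀_lineSheaf a (by push_cast; ring))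
    (Hom.isZero_coker _ (fun y => ?_) fun y => ?_)
  · obtain ⟨x, hx⟩ := cechP1_surjective (k := ((n + 1 : ℕ) - 1 : ℤ) + 0) (by omega) y
    exact ⟨x, (cech_twist_lineSheaf a _ 0 x).trans hx⟩
  · obtain ⟨x, hx⟩ := cechP1_surjective (k := ((n + 1 : ℕ) - 1 : ℤ) + -1) (by omega) y
    exact ⟨x, (cech_twist_lineSheaf a _ (-1) x).trans hx⟩

theorem typeV_iff {V : QuiverRep.{u}} {a : ℂ} {n : ℕ} :
    V.TypeV a n ↔ (preprojective a n).swap.Isomorphic V := by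
  refine represents_iff (ker_Φ₀plus_lineSheaf a (by ring))
    (Hom.isZero_coker _ (fun y => ?_) fun y => ?_)
  · obtain ⟨x, hx⟩ := cechP1_surjective (k := (n - 1 : ℤ) + 0) (by omega) y
    exact ⟨x, (cech_twist_lineSheaf a _ 0 x).trans hx⟩
  · obtain ⟨x, hx⟩ := cechP1_surjective (k := (n - 1 : ℤ) + 1) (by omega) y
    exact ⟨x, (cech_twist_lineSheaf a _ 1 x).trans hx⟩

theorem typeII_iff {V : QuiverRep.{u}} {a : ℂ} {n : ℕ} :
    V.TypeII a n ↔ (preinjective a n).Isomorphic V :=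
  shiftRepresents_iff (coker_Φ₀_lineSheaf a (by ring)) (Hom.isZero_ker _
    (fun x hx => cechP1_injective (by omega) ((cech_twist_lineSheaf a _ 0 x).symm.trans hx))
    fun x hx => cechP1_injective (by omega) ((cech_twist_lineSheaf a _ (-1) x).symm.trans hx))

/-- The degrees are `-n - 2` and `-n - 1`, both negative, so `H⁰` vanishes. For parameter `0` the
degree at vertex `1` would be `0`, with `H⁰ ≠ 0`. -/
theorem typeIV_iff {V : QuiverRep.{u}} {a : ℂ} {n : ℕ} :
    V.TypeIV a (n + 1) ↔ (preinjective a n).swap.Isomorphic V :=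
  shiftRepresents_iff (coker_Φ₀plus_lineSheaf a (by push_cast; ring)) (Hom.isZero_ker _
    (fun x hx => cechP1_injective (by omega) ((cech_twist_lineSheaf a _ 0 x).symm.trans hx))
    fun x hx => cechP1_injective (by omega) ((cech_twist_lineSheaf a _ 1 x).symm.trans hx))

/-! ### The two functors on skyscraper sheaves. -/

namespace HPoint

variable (x : HPoint)

theorem s_one_ne (h : x.s 0 = 0) : x.s 1 ≠ 0 := fun h' =>
  x.s_ne (funext fun i => by fin_cases i <;> assumption)

/-- Functions on the two charts of the point `x`. -/
abbrev Cochain : Type := (PLift (x.s 0 ≠ 0) → ℂ) × (PLift (x.s 1 ≠ 0) → ℂ)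

/-- The function on the overlap that is given by a power of the transition function. -/
def transition (n : ℤ) : (PLift (x.s 0 ≠ 0 ∧ x.s 1 ≠ 0) → ℂ)ˣ :=
  Units.map ((AlgHom.pi fun h => x.evalOverlap h.down :
    Overlap →ₐ[ℂ] (PLift (x.s 0 ≠ 0 ∧ x.s 1 ≠ 0) → ℂ)) : Overlap →* _) (z ^ n)

theorem cech_twist_sheaf (n : ℤ) (v : x.Cochain) (h) :
    (show PLift (x.s 0 ≠ 0 ∧ x.s 1 ≠ 0) → ℂ from (x.sheaf.twist n).cech v) h =
      v.1 ⟨h.down.1⟩ - (x.transition n).1 h * v.2 ⟨h.down.2⟩ := by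
  change v.1 ⟨h.down.1⟩ - (x.transition n).1 h * (1 * v.2 ⟨h.down.2⟩) = _
  rw [one_mul]

/-- A function on the overlap extends by zero to the first chart, so `H¹` vanishes. -/
theorem cech_twist_sheaf_surjective (n : ℤ) : Function.Surjective (x.sheaf.twist n).cech := by
  classical
  intro y
  let y' : PLift (x.s 0 ≠ 0 ∧ x.s 1 ≠ 0) → ℂ := y
  let v : x.Cochain := (fun h => if h' : x.s 1 ≠ 0 then y' ⟨h.down, h'⟩ else 0, 0)
  refine ⟨v, funext fun h => (x.cech_twist_sheaf n v h).trans ?_⟩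
  change dite _ _ _ - _ * 0 = _
  rw [dif_pos h.down.2, mul_zero, sub_zero]

open Classical in
/-- The coordinate of a section of `𝒪_x(n)`, with respect to the homogeneous coordinates of `x`. -/
def coord (n : ℤ) : x.Cochain →ₗ[ℂ] ℂ :=
  if h : x.s 0 ≠ 0 then
    (x.s 0) ^ n • (LinearMap.proj (⟨h⟩ : PLift (x.s 0 ≠ 0))).comp (LinearMap.fst ℂ _ _)
  else
    (x.s 1) ^ n • (LinearMap.proj (⟨x.s_one_ne (not_not.1 h)⟩ : PLift (x.s 1 ≠ 0))).comp
      (LinearMap.snd ℂ _ _)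

theorem coord_of_ne {n : ℤ} (h : x.s 0 ≠ 0) (v : x.Cochain) :
    x.coord n v = x.s 0 ^ n * v.1 ⟨h⟩ := by
  rw [coord, dif_pos h]; rfl

theorem coord_of_eq {n : ℤ} (h : x.s 0 = 0) (v : x.Cochain) :
    x.coord n v = x.s 1 ^ n * v.2 ⟨x.s_one_ne h⟩ := by
  rw [coord, dif_neg (not_not.2 h)]; rfl

theorem coord_injective (n : ℤ) (v : x.Cochain) (hv : (x.sheaf.twist n).cech v = 0)
    (h : x.coord n v = 0) : v = 0 := by
  obtain ⟨p, q⟩ := v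
  by_cases h0 : x.s 0 = 0
  · rw [coord_of_eq x h0] at h
    refine Prod.ext (funext fun h' => (h'.down h0).elim) (funext fun h' => ?_)
    exact (mul_eq_zero.1 h).resolve_left (zpow_ne_zero _ (x.s_one_ne h0))
  · rw [coord_of_ne x h0] at h
    have hp : p ⟨h0⟩ = 0 := (mul_eq_zero.1 h).resolve_left (zpow_ne_zero _ h0)
    refine Prod.ext (funext fun h' => hp) (funext fun h' => ?_)
    have := (x.cech_twist_sheaf n (p, q) ⟨h0, h'.down⟩).symm.trans (congrFun hv ⟨h0, h'.down⟩)
    change p ⟨h0⟩ - _ * q ⟨h'.down⟩ = 0 at this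
    rw [hp, zero_sub, neg_eq_zero] at this
    exact (mul_eq_zero.1 this).resolve_left
      (((x.transition n).isUnit.map (Pi.evalRingHom _ _)).ne_zero)

theorem exists_coord_eq (n : ℤ) (c : ℂ) :
    ∃ v : x.Cochain, (x.sheaf.twist n).cech v = 0 ∧ x.coord n v = c := by
  by_cases h0 : x.s 0 = 0
  · refine ⟨(0, fun _ => (x.s 1 ^ n)⁻¹ * c), funext fun h => (h.down.1 h0).elim, ?_⟩
    rw [coord_of_eq x h0, mul_inv_cancel_left₀ (zpow_ne_zero _ (x.s_one_ne h0))]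
  · let v : x.Cochain := (fun _ => (x.s 0 ^ n)⁻¹ * c,
      fun h => (x.transition n).inv ⟨h0, h.down⟩ * ((x.s 0 ^ n)⁻¹ * c))
    refine ⟨v, funext fun h => (x.cech_twist_sheaf n v h).trans ?_, ?_⟩
    · change (x.s 0 ^ n)⁻¹ * c - (x.transition n).1 h * ((x.transition n).inv h * _) = 0
      have := congrFun (x.transition n).val_inv h
      change (x.transition n).1 h * (x.transition n).inv h = 1 at this
      rw [← mul_assoc, this, one_mul, sub_self]
    · rw [coord_of_ne x h0, mul_inv_cancel_left₀ (zpow_ne_zero _ h0)]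

/-- The factor `sᵢᵏ` turns the local value of a section of `𝒪(k)` in the chart `sᵢ ≠ 0` into its
homogeneous value `r` at `x`, the same in both charts. In the coordinate `coord`, the sections `sᵢ`,
`wᵢ`, `t` therefore act as the homogeneous coordinates of `x` themselves. -/
theorem coord_mul₀ {n k l : ℤ} (σ : LineSection k) (r : ℂ) (hl : n + k = l)
    (h₀ : x.s 0 ≠ 0 → x.s 0 ^ k * x.eval 0 1 σ.f₀ = r)
    (h₁ : x.s 1 ≠ 0 → x.s 1 ^ k * x.eval 1 0 σ.f₁ = r) (v : x.Cochain) :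
    x.coord l (x.sheaf.mul₀ σ v) = r * x.coord n v := by
  subst hl
  by_cases h : x.s 0 = 0
  · refine (x.coord_of_eq h _).trans ?_
    rw [coord_of_eq x h, zpow_add₀ (x.s_one_ne h), ← h₁ (x.s_one_ne h)]
    change _ * (x.eval 1 0 σ.f₁ * v.2 _) = _
    ring
  · refine (x.coord_of_ne h _).trans ?_
    rw [coord_of_ne x h, zpow_add₀ h, ← h₀ h]
    change _ * (x.eval 0 1 σ.f₀ * v.1 _) = _
    ring

theorem coord_mul₀_sSec {n l : ℤ} (hl : n + 1 = l) (i : Fin 2) (v : x.Cochain) :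
    x.coord l (x.sheaf.mul₀ (sSec i) v) = x.s i * x.coord n v := by
  refine x.coord_mul₀ _ _ hl (fun h => ?_) (fun h => ?_) v <;> fin_cases i <;>
    simp [sSec, eval] <;> field_simp

theorem coord_mul₀_wSec {n l : ℤ} (hl : n + -1 = l) (i : Fin 2) (v : x.Cochain) :
    x.coord l (x.sheaf.mul₀ (wSec i) v) = x.w i * x.coord n v := by
  refine x.coord_mul₀ _ _ hl (fun h => ?_) (fun h => ?_) v <;> fin_cases i <;>
    simp [wSec, eval, h]

theorem coord_mul₀_tSec (n : ℤ) (v : x.Cochain) :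
    x.coord n (x.sheaf.mul₀ tSec v) = x.t * x.coord n v := by
  refine x.coord_mul₀ _ _ (add_zero n) (fun h => ?_) (fun h => ?_) v <;>
    simp [tSec, eval]

open QuiverRep

theorem ker_Φ₀_sheaf : x.sheaf.Φ₀.ker.Isomorphic (point x.s x.w x.t) := by
  refine Hom.ker_isomorphic (P₀ := ℂ) (P₁ := ℂ) _ (x.coord 0) (x.coord (-1)) LinearMap.id
    LinearMap.id Function.injective_id Function.injective_id (x.coord_injective 0)
    (x.coord_injective (-1)) (x.exists_coord_eq 0) (x.exists_coord_eq (-1)) (fun _ _ => ⟨_, rfl⟩)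
    (fun _ _ => ⟨_, rfl⟩) ?_ ?_ ?_ ?_
  · exact fun i v _ h => (x.coord_mul₀_wSec (by norm_num) i v).trans (congrArg _ h)
  · exact fun i v _ h => (x.coord_mul₀_sSec (by norm_num) i v).trans (congrArg _ h)
  · exact fun v _ h => (x.coord_mul₀_tSec _ v).trans (congrArg _ h)
  · exact fun v _ h => (x.coord_mul₀_tSec _ v).trans (congrArg _ h)

theorem ker_Φ₀plus_sheaf : x.sheaf.Φ₀plus.ker.Isomorphic (point x.s x.w x.t).swap := by
  refine Hom.ker_isomorphic (P₀ := ℂ) (P₁ := ℂ) _ (x.coord 0) (x.coord 1) LinearMap.id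
    LinearMap.id Function.injective_id Function.injective_id (x.coord_injective 0)
    (x.coord_injective 1) (x.exists_coord_eq 0) (x.exists_coord_eq 1) (fun _ _ => ⟨_, rfl⟩)
    (fun _ _ => ⟨_, rfl⟩) ?_ ?_ ?_ ?_
  · exact fun i v _ h => (x.coord_mul₀_sSec (by norm_num) i v).trans (congrArg _ h)
  · exact fun i v _ h => (x.coord_mul₀_wSec (by norm_num) i v).trans (congrArg _ h)
  · exact fun v _ h => (x.coord_mul₀_tSec _ v).trans (congrArg _ h)
  · exact fun v _ h => (x.coord_mul₀_tSec _ v).trans (congrArg _ h)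

theorem typeIII_iff {V : QuiverRep.{u}} : V.TypeIII x ↔ (point x.s x.w x.t).Isomorphic V :=
  represents_iff x.ker_Φ₀_sheaf (Hom.isZero_coker _ (x.cech_twist_sheaf_surjective 0)
    (x.cech_twist_sheaf_surjective (-1)))

theorem typeVI_iff {V : QuiverRep.{u}} : V.TypeVI x ↔ (point x.s x.w x.t).swap.Isomorphic V :=
  represents_iff x.ker_Φ₀plus_sheaf (Hom.isZero_coker _ (x.cech_twist_sheaf_surjective 0)
    (x.cech_twist_sheaf_surjective 1))

end HPoint

/-! ### Stability in terms of the six types, and the walls of the models. -/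

namespace QuiverRep

/-- A representation in a larger universe. -/
def lift (V : QuiverRep.{v}) : QuiverRep.{max u v} where
  V₀ := ULift.{u} V.V₀
  V₁ := ULift.{u} V.V₁
  a i := ULift.moduleEquiv.symm.toLinearMap.comp ((V.a i).comp ULift.moduleEquiv.toLinearMap)
  b i := ULift.moduleEquiv.symm.toLinearMap.comp ((V.b i).comp ULift.moduleEquiv.toLinearMap)
  c := ULift.moduleEquiv.symm.toLinearMap.comp (V.c.comp ULift.moduleEquiv.toLinearMap)
  d := ULift.moduleEquiv.symm.toLinearMap.comp (V.d.comp ULift.moduleEquiv.toLinearMap)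
  rel_aba i x := congrArg ULift.up (V.rel_aba i x.down)
  rel_bab i x := congrArg ULift.up (V.rel_bab i x.down)
  rel_da i x := congrArg ULift.up (V.rel_da i x.down)
  rel_cb i x := congrArg ULift.up (V.rel_cb i x.down)

theorem isomorphic_lift (V : QuiverRep.{v}) : V.Isomorphic (lift.{u} V) :=
  ⟨⟨ULift.moduleEquiv.symm.toLinearMap, ULift.moduleEquiv.symm.toLinearMap, fun _ _ => rfl,
    fun _ _ => rfl, fun _ => rfl, fun _ => rfl⟩, ULift.moduleEquiv.symm.bijective,
    ULift.moduleEquiv.symm.bijective⟩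

theorem not_isZero_preprojective (t : ℂ) (n : ℕ) : ¬ (preprojective t n).IsZero := fun ⟨h, _⟩ => by
  have := @Module.finrank_zero_of_subsingleton ℂ (preprojective t n).V₀ _ _ _ _ h
  exact absurd ((finrank_degreeLT (n + 1)).symm.trans this) n.succ_ne_zero

theorem not_isZero_preinjective (t : ℂ) (n : ℕ) : ¬ (preinjective t n).IsZero := fun ⟨_, h⟩ =>
  not_subsingleton (Fin (n + 1) → ℂ) h

theorem not_isZero_point (s w : Fin 2 → ℂ) (t : ℂ) : ¬ (point s w t).IsZero := fun ⟨_, h⟩ =>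
  not_subsingleton ℂ h

theorem exists_isomorphic {M : QuiverRep.{0}} (hf : M.IsFinite) (hz : ¬ M.IsZero) :
    ∃ V : QuiverRep.{u}, V.IsFinite ∧ ¬ V.IsZero ∧ M.Isomorphic V :=
  ⟨lift.{u} M, M.isomorphic_lift.isFinite hf, fun h => hz (M.isomorphic_lift.symm.isZero h),
    M.isomorphic_lift⟩

theorem swap_isomorphic_iff {M : QuiverRep.{v}} {V : QuiverRep.{u}} :
    M.swap.Isomorphic V ↔ M.Isomorphic V.swap :=
  ⟨fun h => h.swap, fun h => h.swap⟩

theorem exists_typeI_iff {V : QuiverRep.{u}} : (∃ (a : ℂ) (m : ℕ), 1 ≤ m ∧ V.TypeI a m) ↔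
    ∃ t n, (preprojective t n).Isomorphic V := by
  refine exists_congr fun a => ⟨fun ⟨m, hm, h⟩ => ?_, fun ⟨n, h⟩ => ⟨n + 1, by omega, typeI_iff.2 h⟩⟩
  obtain ⟨n, rfl⟩ := Nat.exists_eq_add_of_le' hm
  exact ⟨n, typeI_iff.1 h⟩

theorem exists_typeIV_iff {V : QuiverRep.{u}} : (∃ (a : ℂ) (m : ℕ), 1 ≤ m ∧ V.TypeIV a m) ↔
    ∃ t n, (preinjective t n).Isomorphic V.swap := by
  refine exists_congr fun a => ⟨fun ⟨m, hm, h⟩ => ?_, fun ⟨n, h⟩ =>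
    ⟨n + 1, by omega, typeIV_iff.2 (swap_isomorphic_iff.2 h)⟩⟩
  obtain ⟨n, rfl⟩ := Nat.exists_eq_add_of_le' hm
  exact ⟨n, swap_isomorphic_iff.1 (typeIV_iff.1 h)⟩

theorem negStable_iff_type {V : QuiverRep.{u}} (hf : V.IsFinite) (hz : ¬ V.IsZero) :
    V.NegStable ↔ (∃ (a : ℂ) (m : ℕ), 1 ≤ m ∧ V.TypeI a m) ∨ (∃ (a : ℂ) (m : ℕ), V.TypeII a m) ∨
      ∃ x : HPoint, V.TypeIII x := by
  simp only [negStable_iff hf hz, exists_typeI_iff, typeII_iff, HPoint.typeIII_iff]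

theorem negStable_swap_iff_type {V : QuiverRep.{u}} (hf : V.IsFinite) (hz : ¬ V.IsZero) :
    V.swap.NegStable ↔ (∃ (a : ℂ) (m : ℕ), 1 ≤ m ∧ V.TypeIV a m) ∨
      (∃ (a : ℂ) (m : ℕ), V.TypeV a m) ∨ ∃ x : HPoint, V.TypeVI x := by
  simp only [negStable_iff hf.swap (isZero_swap.not.2 hz), exists_typeIV_iff, typeV_iff,
    HPoint.typeVI_iff, swap_isomorphic_iff]
  exact or_left_comm

theorem isStable_iff_negStable_swap {V : QuiverRep.{u}} (hf : V.IsFinite) {Θ : ℝ × ℝ}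
    (hΘ : Θ.2 < Θ.1) : V.IsStable Θ ↔ V.swap.NegStable := by
  rw [← isStable_swap, isStable_iff_negStable hf.swap hΘ]

theorem Sub.slope_of_eq {V : QuiverRep.{u}} (hf : V.IsFinite) {W : V.Sub} (hb : ¬ W.IsBot)
    {Θ : ℝ × ℝ} (h : Θ.1 = Θ.2) : W.slope Θ = Θ.2 := by
  have hW : (0 : ℝ) < Module.finrank ℂ W.W₀ + Module.finrank ℂ W.W₁ := by
    exact_mod_cast W.finrank_add_pos hf hb
  rw [Sub.slope, Sub.theta, h, ← mul_add, mul_div_cancel_right₀ _ hW.ne']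

/-- Parameters on the diagonal have only simple representations as stable ones. -/
theorem IsStable.negStable_of_eq {V : QuiverRep.{u}} (hf : V.IsFinite) {Θ : ℝ × ℝ}
    (h : Θ.1 = Θ.2) (hV : V.IsStable Θ) : V.NegStable := by
  intro W hb ht
  have := hV W hb ht
  have hp := W.finrank_add_pos hf hb
  rw [Sub.slope_of_eq hf hb h] at this
  obtain ⟨_, _⟩ := hf
  have h₀ := W.W₀.finrank_le
  have h₁ := W.W₁.finrank_le
  have hpos : (0 : ℝ) < Module.finrank ℂ V.V₀ + Module.finrank ℂ V.V₁ := by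
    exact_mod_cast (by omega)
  rw [slope, theta, h, ← mul_add, mul_div_cancel_right₀ _ hpos.ne'] at this
  -- On the diagonal all slopes are equal, so no non-zero proper `W` exists and the required
  -- inequality is vacuous.
  exact absurd this (lt_irrefl _)

theorem exists_isStable_iff {V : QuiverRep.{u}} (hf : V.IsFinite) :
    (∃ Θ, V.IsStable Θ) ↔ V.NegStable ∨ V.swap.NegStable := by
  constructor
  · rintro ⟨Θ, h⟩
    rcases lt_trichotomy Θ.1 Θ.2 with hΘ | hΘ | hΘ
    · exact .inl ((isStable_iff_negStable hf hΘ).1 h)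
    · exact .inl (h.negStable_of_eq hf hΘ)
    · exact .inr ((isStable_iff_negStable_swap hf hΘ).1 h)
  · rintro (h | h)
    · exact ⟨(0, 1), (isStable_iff_negStable hf zero_lt_one).2 h⟩
    · exact ⟨(1, 0), (isStable_iff_negStable_swap hf zero_lt_one).2 h⟩

theorem NegStable.wall_inter {V : QuiverRep.{u}} (hV : V.NegStable) (hf : V.IsFinite) :
    V.wall ∩ {Θ | Θ.1 < Θ.2} = {Θ | Θ.1 < Θ.2 ∧ V.theta Θ = 0} := by
  ext Θ
  exact ⟨fun h => ⟨h.2, h.1.2⟩, fun h => ⟨⟨(isStable_iff_negStable hf h.1).2 hV, h.2⟩, h.1⟩⟩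

/-- If the `aᵢ` vanish, `(V₀, 0)` is a subrepresentation of slope `θ₀`. The slope of `V` is a
weighted mean of `θ₀` and `θ₁` with positive weights, so stability forces `θ₀ < θ₁`. -/
theorem wall_subset {V : QuiverRep.{u}} (ha : ∀ i, V.a i = 0)
    (h₀ : 0 < Module.finrank ℂ V.V₀) (h₁ : 0 < Module.finrank ℂ V.V₁) :
    V.wall ⊆ {Θ | Θ.1 < Θ.2} := by
  intro Θ hΘ
  let W : V.Sub :=
    { W₀ := ⊤
      W₁ := ⊥
      a_mem := fun i x _ => by rw [ha]; exact zero_mem _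
      b_mem := fun _ _ _ => trivial
      c_mem := fun _ _ => trivial
      d_mem := fun x hx => by rw [(Submodule.mem_bot ℂ).1 hx, map_zero]; exact zero_mem _ }
  have k₀ : Module.finrank ℂ W.W₀ = Module.finrank ℂ V.V₀ := finrank_top _ _
  have k₁ : Module.finrank ℂ W.W₁ = 0 := finrank_bot _ _
  have h := hΘ.1 W (fun h => by rw [h.1, finrank_bot] at k₀; omega)
    fun h => by rw [h.2, finrank_top] at k₁; omega
  have p₀ : (0 : ℝ) < Module.finrank ℂ V.V₀ := by exact_mod_cast h₀
  have p₁ : (0 : ℝ) < Module.finrank ℂ V.V₁ := by exact_mod_cast h₁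
  rw [Sub.slope, Sub.theta, slope, theta, k₀, k₁, Nat.cast_zero, mul_zero, add_zero, add_zero,
    mul_div_cancel_right₀ _ p₀.ne', lt_div_iff₀ (add_pos p₀ p₁), mul_add, add_lt_add_iff_left,
    mul_lt_mul_iff_left₀ p₁] at h
  exact h

theorem wall_preprojective (t : ℂ) (n : ℕ) :
    (preprojective t n).wall ∩ {Θ | Θ.1 < Θ.2} = wallMinusMinus (n + 1) ∧
      (1 ≤ n → (preprojective t n).wall = wallMinusMinus (n + 1)) := by
  have e₀ : Module.finrank ℂ (preprojective t n).V₀ = n + 1 := finrank_degreeLT _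
  have e₁ : Module.finrank ℂ (preprojective t n).V₁ = n := finrank_degreeLT _
  have h : (preprojective t n).wall ∩ {Θ | Θ.1 < Θ.2} = wallMinusMinus (n + 1) := by
    rw [(negStable_preprojective t n).wall_inter (isFinite_preprojective t n)]
    simp only [theta, e₀, e₁, wallMinusMinus]
    push_cast
    simp only [add_sub_cancel_right, mul_comm]
  refine ⟨h, fun hn => ?_⟩
  rw [← h, Set.inter_eq_left.2 (wall_subset (fun _ => rfl) (by omega) (by omega))]

theorem wall_preinjective (t : ℂ) (n : ℕ) :
    (preinjective t n).wall ∩ {Θ | Θ.1 < Θ.2} = wallPlusMinus n ∧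
      (1 ≤ n → (preinjective t n).wall = wallPlusMinus n) := by
  have e₀ : Module.finrank ℂ (preinjective t n).V₀ = n := Module.finrank_fin_fun ℂ
  have e₁ : Module.finrank ℂ (preinjective t n).V₁ = n + 1 := Module.finrank_fin_fun ℂ
  have h : (preinjective t n).wall ∩ {Θ | Θ.1 < Θ.2} = wallPlusMinus n := by
    rw [(negStable_preinjective t n).wall_inter (isFinite_preinjective t n)]
    simp only [theta, e₀, e₁, wallPlusMinus]
    push_cast
    simp only [mul_comm]
  refine ⟨h, fun hn => ?_⟩
  rw [← h, Set.inter_eq_left.2 (wall_subset (fun _ => rfl) (by omega) (by omega))]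

theorem wall_point (x : HPoint) :
    (point x.s x.w x.t).wall ∩ {Θ | Θ.1 < Θ.2} = wallInfMinus ∧
      (x.w = 0 → (point x.s x.w x.t).wall = wallInfMinus) := by
  have e₀ : Module.finrank ℂ (point x.s x.w x.t).V₀ = 1 := Module.finrank_self ℂ
  have e₁ : Module.finrank ℂ (point x.s x.w x.t).V₁ = 1 := Module.finrank_self ℂ
  have h : (point x.s x.w x.t).wall ∩ {Θ | Θ.1 < Θ.2} = wallInfMinus := by
    rw [(negStable_point x.s_ne x.w x.t).wall_inter (isFinite_point _ _ _)]
    simp only [theta, e₀, e₁, wallInfMinus, Nat.cast_one, mul_one]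
  refine ⟨h, fun hw => ?_⟩
  rw [← h, Set.inter_eq_left.2 (wall_subset (fun i => ?_) (by omega) (by omega))]
  change x.w i • LinearMap.id = 0
  rw [hw, Pi.zero_apply, zero_smul]

/-- The walls of the flopped representations. -/
theorem wall_swap_model {M : QuiverRep.{0}} {L L' : Set (ℝ × ℝ)} {p : Prop}
    (h : M.wall ∩ {Θ | Θ.1 < Θ.2} = L ∧ (p → M.wall = L)) (hL : L' = Prod.swap ⁻¹' L) :
    M.swap.wall ∩ {Θ | Θ.2 < Θ.1} = L' ∧ (p → M.swap.wall = L') := by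
  rw [hL, wall_swap]
  exact ⟨congrArg (Prod.swap ⁻¹' ·) h.1, fun hp => congrArg (Prod.swap ⁻¹' ·) (h.2 hp)⟩

end QuiverRep

theorem wallMinusPlus_succ (n : ℕ) : wallMinusPlus (n + 1) = Prod.swap ⁻¹' wallPlusMinus n := by
  ext Θ
  change _ ∧ ((n + 1 : ℕ) : ℝ) * Θ.1 + (((n + 1 : ℕ) : ℝ) - 1) * Θ.2 = 0 ↔
    _ ∧ (n : ℝ) * Θ.2 + ((n : ℝ) + 1) * Θ.1 = 0
  push_cast
  rw [add_sub_cancel_right, add_comm]; rfl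

theorem wallPlusPlus_eq (n : ℕ) : wallPlusPlus n = Prod.swap ⁻¹' wallMinusMinus (n + 1) := by
  ext Θ
  change _ ∧ (n : ℝ) * Θ.1 + ((n : ℝ) + 1) * Θ.2 = 0 ↔
    _ ∧ ((n + 1 : ℕ) : ℝ) * Θ.2 + (((n + 1 : ℕ) : ℝ) - 1) * Θ.1 = 0
  push_cast
  rw [add_sub_cancel_right, add_comm]; rfl

theorem wallInfPlus_eq : wallInfPlus = Prod.swap ⁻¹' wallInfMinus := by
  ext Θ
  change _ ∧ Θ.1 + Θ.2 = 0 ↔ _ ∧ Θ.2 + Θ.1 = 0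
  rw [add_comm]; rfl

/-! ### Semistability, subquotients and the walls for framed representations. -/

namespace QuiverRep

namespace Sub

variable {V : QuiverRep.{u}} (W : V.Sub)

/-- A subrepresentation as a representation. -/
def toRep : QuiverRep.{u} where
  V₀ := W.W₀
  V₁ := W.W₁
  a i := (V.a i).restrict (W.a_mem i)
  b i := (V.b i).restrict (W.b_mem i)
  c := V.c.restrict W.c_mem
  d := V.d.restrict W.d_mem
  rel_aba i x := Subtype.ext (V.rel_aba i x)
  rel_bab i x := Subtype.ext (V.rel_bab i x)
  rel_da i x := Subtype.ext (V.rel_da i x)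
  rel_cb i x := Subtype.ext (V.rel_cb i x)

/-- The quotient by a subrepresentation. -/
def quot : QuiverRep.{u} where
  V₀ := V.V₀ ⧸ W.W₀
  V₁ := V.V₁ ⧸ W.W₁
  a i := Submodule.mapQ _ _ (V.a i) (W.a_mem i)
  b i := Submodule.mapQ _ _ (V.b i) (W.b_mem i)
  c := Submodule.mapQ _ _ V.c W.c_mem
  d := Submodule.mapQ _ _ V.d W.d_mem
  rel_aba i x := by
    obtain ⟨x, rfl⟩ := Submodule.Quotient.mk_surjective _ x
    simp only [Submodule.mapQ_apply, V.rel_aba]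
  rel_bab i x := by
    obtain ⟨x, rfl⟩ := Submodule.Quotient.mk_surjective _ x
    simp only [Submodule.mapQ_apply, V.rel_bab]
  rel_da i x := by
    obtain ⟨x, rfl⟩ := Submodule.Quotient.mk_surjective _ x
    simp only [Submodule.mapQ_apply, V.rel_da]
  rel_cb i x := by
    obtain ⟨x, rfl⟩ := Submodule.Quotient.mk_surjective _ x
    simp only [Submodule.mapQ_apply, V.rel_cb]

theorem isFinite_toRep (hf : V.IsFinite) : W.toRep.IsFinite := by
  obtain ⟨_, _⟩ := hf
  exact ⟨inferInstanceAs (FiniteDimensional ℂ W.W₀), inferInstanceAs (FiniteDimensional ℂ W.W₁)⟩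

theorem isFinite_quot (hf : V.IsFinite) : W.quot.IsFinite := by
  obtain ⟨_, _⟩ := hf
  exact ⟨inferInstanceAs (FiniteDimensional ℂ (V.V₀ ⧸ W.W₀)),
    inferInstanceAs (FiniteDimensional ℂ (V.V₁ ⧸ W.W₁))⟩

theorem isZero_toRep_iff : W.toRep.IsZero ↔ W.IsBot :=
  and_congr Submodule.subsingleton_iff_eq_bot Submodule.subsingleton_iff_eq_bot

theorem isZero_quot_iff : W.quot.IsZero ↔ W.IsTop :=
  and_congr Submodule.Quotient.subsingleton_iff Submodule.Quotient.subsingleton_iff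

theorem theta_quot (hf : V.IsFinite) (Θ : ℝ × ℝ) : W.quot.theta Θ = V.theta Θ - W.theta Θ := by
  obtain ⟨_, _⟩ := hf
  change Θ.1 * (Module.finrank ℂ (V.V₀ ⧸ W.W₀) : ℝ) + Θ.2 * (Module.finrank ℂ (V.V₁ ⧸ W.W₁) : ℝ) = _
  rw [QuiverRep.theta, Sub.theta, ← W.W₀.finrank_quotient_add_finrank,
    ← W.W₁.finrank_quotient_add_finrank]
  push_cast
  ring

/-- The image in `V` of a subrepresentation of `W`. -/
def ofSub (U : W.toRep.Sub) : V.Sub where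
  W₀ := Submodule.map W.W₀.subtype U.W₀
  W₁ := Submodule.map W.W₁.subtype U.W₁
  a_mem := by rintro i _ ⟨x, hx, rfl⟩; exact ⟨_, U.a_mem i x hx, rfl⟩
  b_mem := by rintro i _ ⟨x, hx, rfl⟩; exact ⟨_, U.b_mem i x hx, rfl⟩
  c_mem := by rintro _ ⟨x, hx, rfl⟩; exact ⟨_, U.c_mem x hx, rfl⟩
  d_mem := by rintro _ ⟨x, hx, rfl⟩; exact ⟨_, U.d_mem x hx, rfl⟩

theorem theta_ofSub (U : W.toRep.Sub) (Θ : ℝ × ℝ) : (W.ofSub U).theta Θ = U.theta Θ := by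
  rw [Sub.theta, Sub.theta]
  congr 3
  · exact Submodule.finrank_map_subtype_eq W.W₀ U.W₀
  · exact Submodule.finrank_map_subtype_eq W.W₁ U.W₁

theorem isBot_of_ofSub (U : W.toRep.Sub) (h : (W.ofSub U).IsBot) : U.IsBot :=
  ⟨Submodule.map_injective_of_injective W.W₀.injective_subtype (h.1.trans (Submodule.map_bot _).symm),
    Submodule.map_injective_of_injective W.W₁.injective_subtype (h.2.trans (Submodule.map_bot _).symm)⟩

/-- The preimage in `V` of a subrepresentation of `V / W`. -/
def ofQuot (U : W.quot.Sub) : V.Sub where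
  W₀ := Submodule.comap W.W₀.mkQ U.W₀
  W₁ := Submodule.comap W.W₁.mkQ U.W₁
  a_mem i _ hx := U.a_mem i _ hx
  b_mem i _ hx := U.b_mem i _ hx
  c_mem _ hx := U.c_mem _ hx
  d_mem _ hx := U.d_mem _ hx

theorem le_ofQuot (U : W.quot.Sub) : W.W₀ ≤ (W.ofQuot U).W₀ := by
  intro x hx
  change W.W₀.mkQ x ∈ U.W₀
  rw [Submodule.mkQ_apply, (Submodule.Quotient.mk_eq_zero _).2 hx]
  exact zero_mem _

theorem finrank_comap_mkQ {E : Type*} [AddCommGroup E] [Module ℂ E] [FiniteDimensional ℂ E]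
    (p : Submodule ℂ E) (q : Submodule ℂ (E ⧸ p)) :
    Module.finrank ℂ (q.comap p.mkQ) = Module.finrank ℂ q + Module.finrank ℂ p := by
  have h := (p.mkQ.domRestrict (q.comap p.mkQ)).finrank_range_add_finrank_ker
  have hr : LinearMap.range (p.mkQ.domRestrict (q.comap p.mkQ)) = q := by
    rw [LinearMap.range_domRestrict, Submodule.map_comap_eq_of_surjective p.mkQ_surjective]
  have hk : LinearMap.ker (p.mkQ.domRestrict (q.comap p.mkQ)) = p.comap (q.comap p.mkQ).subtype := by
    rw [LinearMap.ker_domRestrict, Submodule.ker_mkQ]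
  have hle : p ≤ q.comap p.mkQ := by
    intro x hx
    rw [Submodule.mem_comap, Submodule.mkQ_apply, (Submodule.Quotient.mk_eq_zero _).2 hx]
    exact zero_mem _
  rw [hr, hk, (Submodule.comapSubtypeEquivOfLe hle).finrank_eq] at h
  exact h.symm

theorem theta_ofQuot (hf : V.IsFinite) (U : W.quot.Sub) (Θ : ℝ × ℝ) :
    (W.ofQuot U).theta Θ = U.theta Θ + W.theta Θ := by
  obtain ⟨_, _⟩ := hf
  have h₀ : Module.finrank ℂ (W.ofQuot U).W₀ = Module.finrank ℂ U.W₀ + Module.finrank ℂ W.W₀ :=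
    finrank_comap_mkQ W.W₀ U.W₀
  have h₁ : Module.finrank ℂ (W.ofQuot U).W₁ = Module.finrank ℂ U.W₁ + Module.finrank ℂ W.W₁ :=
    finrank_comap_mkQ W.W₁ U.W₁
  rw [Sub.theta, h₀, h₁, Sub.theta, Sub.theta]
  push_cast
  ring

end Sub

/-- A semistable representation with `Θ(V) = 0` contains a stable one. -/
theorem exists_isStable_of_semistable {Θ : ℝ × ℝ} {V : QuiverRep.{u}} (hf : V.IsFinite)
    (hz : ¬ V.IsZero) (h0 : V.theta Θ = 0) (h : ∀ W : V.Sub, ¬ W.IsBot → W.theta Θ ≤ 0) :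
    ∃ S : QuiverRep.{u}, S.IsFinite ∧ ¬ S.IsZero ∧ Θ ∈ S.wall := by
  induction hn : Module.finrank ℂ V.V₀ + Module.finrank ℂ V.V₁ using Nat.strong_induction_on
    generalizing V with
  | _ n ih =>
  subst hn
  by_cases hs : V.IsStable Θ
  · exact ⟨V, hf, hz, hs, h0⟩
  rw [IsStable] at hs
  push Not at hs
  obtain ⟨W, hb, ht, hW⟩ := hs
  have hp : (0 : ℝ) < Module.finrank ℂ W.W₀ + Module.finrank ℂ W.W₁ := by
    exact_mod_cast W.finrank_add_pos hf hb
  rw [slope, h0, zero_div, Sub.slope] at hW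
  -- A subrepresentation that violates stability has slope at least `0`, and semistability gives
  -- `Θ(W) ≤ 0`. So `W` satisfies the hypotheses again, in smaller dimension.
  have hW0 : W.theta Θ = 0 := by
    refine le_antisymm (h W hb) ?_
    by_contra! hlt
    exact absurd hW (not_le.2 (div_neg_of_neg_of_pos hlt hp))
  refine ih _ ?_ (W.isFinite_toRep hf) (W.isZero_toRep_iff.not.2 hb) hW0 (fun U hU => ?_) rfl
  · obtain ⟨_, _⟩ := hf
    change Module.finrank ℂ W.W₀ + Module.finrank ℂ W.W₁ < _
    have h₀ := W.W₀.finrank_le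
    have h₁ := W.W₁.finrank_le
    by_contra! hle
    exact ht ⟨Submodule.eq_top_of_finrank_eq (by omega), Submodule.eq_top_of_finrank_eq (by omega)⟩
  · rw [← W.theta_ofSub]
    exact h _ fun hb => hU (W.isBot_of_ofSub U hb)

theorem Isomorphic.exists_mem_wall {M : QuiverRep.{0}} (hf : M.IsFinite) (hz : ¬ M.IsZero)
    {Θ : ℝ × ℝ} (h : Θ ∈ M.wall) :
    ∃ V : QuiverRep.{u}, V.IsFinite ∧ ¬ V.IsZero ∧ Θ ∈ V.wall := by
  obtain ⟨V, hf, hz, e⟩ := exists_isomorphic hf hz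
  exact ⟨V, hf, hz, e.wall_eq ▸ h⟩

/-- The classification reduces this to the walls of the models. These do not depend on the loop
scalar or on the point, so for the converse one model of each kind suffices. -/
theorem exists_mem_wall_iff {Θ : ℝ × ℝ} (hΘ : Θ.1 < Θ.2) :
    (∃ V : QuiverRep.{u}, V.IsFinite ∧ ¬ V.IsZero ∧ Θ ∈ V.wall) ↔
      (∃ n : ℕ, Θ ∈ wallMinusMinus (n + 1)) ∨ (∃ n : ℕ, Θ ∈ wallPlusMinus n) ∨ Θ ∈ wallInfMinus := by
  constructor
  · rintro ⟨V, hf, hz, h⟩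
    rcases (negStable_iff hf hz).1 ((isStable_iff_negStable hf hΘ).1 h.1) with
      ⟨t, n, e⟩ | ⟨t, n, e⟩ | ⟨x, e⟩ <;> rw [← e.wall_eq] at h
    · exact .inl ⟨n, (wall_preprojective t n).1 ▸ ⟨h, hΘ⟩⟩
    · exact .inr (.inl ⟨n, (wall_preinjective t n).1 ▸ ⟨h, hΘ⟩⟩)
    · exact .inr (.inr ((wall_point x).1 ▸ ⟨h, hΘ⟩))
  · rintro (⟨n, h⟩ | ⟨n, h⟩ | h)
    · rw [← (wall_preprojective 0 n).1] at h
      exact Isomorphic.exists_mem_wall (isFinite_preprojective 0 n) (not_isZero_preprojective 0 n) h.1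
    · rw [← (wall_preinjective 0 n).1] at h
      exact Isomorphic.exists_mem_wall (isFinite_preinjective 0 n) (not_isZero_preinjective 0 n) h.1
    · rw [← (wall_point ⟨fun _ => 1, 0, 0, one_ne_zero⟩).1] at h
      exact Isomorphic.exists_mem_wall (isFinite_point _ _ _) (not_isZero_point _ _ _) h.1

theorem exists_mem_wall_iff_swap {Θ : ℝ × ℝ} :
    (∃ V : QuiverRep.{u}, V.IsFinite ∧ ¬ V.IsZero ∧ Θ ∈ V.wall) ↔
      ∃ V : QuiverRep.{u}, V.IsFinite ∧ ¬ V.IsZero ∧ Θ.swap ∈ V.wall := by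
  constructor <;> rintro ⟨V, hf, hz, h⟩ <;>
    exact ⟨V.swap, hf.swap, isZero_swap.not.2 hz, by rwa [wall_swap]⟩

end QuiverRep

open QuiverRep

/-- Equality in one of the two conditions for semistability gives a subrepresentation `W`, or a
quotient `V / W`, that has `Θ = 0` and is semistable without framing; it contains a stable
representation. In the other direction the zero framing works. -/
theorem FramedRep.mem_walls_iff {Θ : ℝ × ℝ} : Θ ∈ FramedRep.walls.{u} ↔
    ∃ V : QuiverRep.{u}, V.IsFinite ∧ ¬ V.IsZero ∧ Θ ∈ V.wall := by
  constructor
  · rintro ⟨V, hf, hs, hn⟩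
    rw [FramedRep.IsStable, not_and_or] at hn
    push Not at hn
    obtain ⟨W, hb, hW⟩ | ⟨W, hr, ht, hW⟩ := hn
    · refine exists_isStable_of_semistable (W.isFinite_toRep hf) (W.isZero_toRep_iff.not.2 hb)
        (le_antisymm (hs.1 W hb) hW) fun U hU => ?_
      rw [← W.theta_ofSub]
      exact hs.1 _ fun hb => hU (W.isBot_of_ofSub U hb)
    · have hW := le_antisymm (hs.2 W hr ht) hW
      refine exists_isStable_of_semistable (W.isFinite_quot hf) (W.isZero_quot_iff.not.2 ht)
        (by rw [W.theta_quot hf, hW, sub_self]) fun U _ => ?_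
      have hU := W.theta_ofQuot hf U Θ
      -- The framed condition covers only proper subrepresentations; if the preimage of `U` is all
      -- of `V`, then `Θ(U) = Θ(V) - Θ(W) = 0` directly.
      by_cases htop : (W.ofQuot U).IsTop
      · have : (W.ofQuot U).theta Θ = V.toQuiverRep.theta Θ := by
          rw [Sub.theta, htop.1, htop.2, finrank_top, finrank_top]; rfl
        linarith
      · have := hs.2 _ (hr.trans (W.le_ofQuot U)) htop
        linarith
  · rintro ⟨V, hf, hz, hs, h0⟩
    have hle (W : V.Sub) (hb : ¬ W.IsBot) : W.theta Θ ≤ 0 := by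
      by_cases ht : W.IsTop
      · rw [← h0, Sub.theta, ht.1, ht.2, finrank_top, finrank_top]; rfl
      · have hp : (0 : ℝ) < Module.finrank ℂ W.W₀ + Module.finrank ℂ W.W₁ := by
          exact_mod_cast W.finrank_add_pos hf hb
        have := hs W hb ht
        rw [QuiverRep.slope, h0, zero_div, Sub.slope] at this
        by_contra! hlt
        exact absurd this (not_lt.2 (div_pos hlt hp).le)
    refine ⟨⟨V, 0⟩, hf, ⟨hle, fun W _ ht => ?_⟩, fun hst => ?_⟩
    · change W.theta Θ ≤ V.theta Θ
      rw [h0]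
      by_cases hb : W.IsBot
      · rw [Sub.theta, hb.1, hb.2, finrank_bot, finrank_bot]; simp
      · exact hle W hb
    · let T : V.Sub := ⟨⊤, ⊤, fun _ _ _ => trivial, fun _ _ _ => trivial, fun _ _ => trivial,
        fun _ _ => trivial⟩
      have hT : T.theta Θ = V.theta Θ := by
        rw [Sub.theta, finrank_top, finrank_top]; rfl
      have := hst.1 T fun hb => hz
        ⟨Submodule.subsingleton_iff ℂ |>.1 (subsingleton_of_bot_eq_top hb.1.symm),
          Submodule.subsingleton_iff ℂ |>.1 (subsingleton_of_bot_eq_top hb.2.symm)⟩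
      rw [hT, h0] at this
      exact lt_irrefl _ this

theorem FramedRep.walls_diff_zero : FramedRep.walls.{u} \ {((0 : ℝ), (0 : ℝ))} =
    (⋃ (m : ℕ) (_ : 1 ≤ m), wallMinusMinus m) ∪ (⋃ m : ℕ, wallPlusMinus m) ∪ wallInfMinus ∪
      (⋃ (m : ℕ) (_ : 1 ≤ m), wallMinusPlus m) ∪ (⋃ m : ℕ, wallPlusPlus m) ∪ wallInfPlus := by
  have hsucc (L : ℕ → Set (ℝ × ℝ)) (Θ) : (∃ m, 1 ≤ m ∧ Θ ∈ L m) ↔ ∃ n, Θ ∈ L (n + 1) :=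
    ⟨fun ⟨m, hm, h⟩ => ⟨m - 1, by rwa [Nat.sub_add_cancel hm]⟩, fun ⟨n, h⟩ => ⟨n + 1, by omega, h⟩⟩
  ext Θ
  simp only [Set.mem_sdiff, Set.mem_singleton_iff, Set.mem_union, Set.mem_iUnion, exists_prop, hsucc,
    FramedRep.mem_walls_iff, wallMinusPlus_succ, wallPlusPlus_eq, wallInfPlus_eq, Set.mem_preimage]
  constructor
  · rintro ⟨h, hne⟩
    rcases lt_trichotomy Θ.1 Θ.2 with hΘ | hΘ | hΘ
    · have := (exists_mem_wall_iff hΘ).1 h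
      tauto
    · obtain ⟨V, hf, hz, hs, h0⟩ := h
      exfalso
      obtain ⟨_, _⟩ := hf
      rw [theta, hΘ, ← mul_add, mul_eq_zero] at h0
      rcases h0 with h0 | h0
      · exact hne (Prod.ext (hΘ.trans h0) h0)
      · have h0 : Module.finrank ℂ V.V₀ + Module.finrank ℂ V.V₁ = 0 := by exact_mod_cast h0
        exact hz ⟨Module.finrank_zero_iff.1 (Nat.add_eq_zero_iff.1 h0).1,
          Module.finrank_zero_iff.1 (Nat.add_eq_zero_iff.1 h0).2⟩
    · have := (exists_mem_wall_iff (Θ := Θ.swap) hΘ).1 (exists_mem_wall_iff_swap.1 h)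
      tauto
  · intro h
    have : (Θ.1 < Θ.2 ∧ ((∃ n : ℕ, Θ ∈ wallMinusMinus (n + 1)) ∨ (∃ n : ℕ, Θ ∈ wallPlusMinus n) ∨
        Θ ∈ wallInfMinus)) ∨ (Θ.swap.1 < Θ.swap.2 ∧ ((∃ n : ℕ, Θ.swap ∈ wallMinusMinus (n + 1)) ∨
        (∃ n : ℕ, Θ.swap ∈ wallPlusMinus n) ∨ Θ.swap ∈ wallInfMinus)) := by
      rcases h with ((((⟨n, h⟩ | ⟨n, h⟩) | h) | ⟨n, h⟩) | ⟨n, h⟩) | h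
      · exact .inl ⟨h.1, .inl ⟨n, h⟩⟩
      · exact .inl ⟨h.1, .inr (.inl ⟨n, h⟩)⟩
      · exact .inl ⟨h.1, .inr (.inr h)⟩
      · exact .inr ⟨h.1, .inr (.inl ⟨n, h⟩)⟩
      · exact .inr ⟨h.1, .inl ⟨n, h⟩⟩
      · exact .inr ⟨h.1, .inr (.inr h)⟩
    rcases this with ⟨hΘ, h⟩ | ⟨hΘ, h⟩
    · exact ⟨(exists_mem_wall_iff hΘ).2 h, fun he => by rw [he] at hΘ; exact lt_irrefl _ hΘ⟩
    · exact ⟨exists_mem_wall_iff_swap.2 ((exists_mem_wall_iff hΘ).2 h),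
        fun he => by rw [he] at hΘ; exact lt_irrefl _ hΘ⟩

end LocalConifold

end

theorem proposition2p6 :
    -- the trichotomy for stable representations
    (∀ V : QuiverRep.{u}, V.IsFinite → ¬ V.IsZero → ∀ Θ : ℝ × ℝ, V.IsStable Θ →
      (Module.finrank ℂ V.V₀ = 1 ∧ Module.finrank ℂ V.V₁ = 1) ∨
        (∀ i, V.a i = 0) ∨ (∀ i, V.b i = 0)) ∧
    -- the classification: stable for some parameter if and only if of one of the six types
    (∀ V : QuiverRep.{u}, V.IsFinite → ¬ V.IsZero →
      ((∃ Θ : ℝ × ℝ, V.IsStable Θ) ↔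
        (∃ (a : ℂ) (m : ℕ), 1 ≤ m ∧ V.TypeI a m) ∨ (∃ (a : ℂ) (m : ℕ), V.TypeII a m) ∨
        (∃ x : HPoint, V.TypeIII x) ∨
        (∃ (a : ℂ) (m : ℕ), 1 ≤ m ∧ V.TypeIV a m) ∨ (∃ (a : ℂ) (m : ℕ), V.TypeV a m) ∨
        (∃ x : HPoint, V.TypeVI x))) ∧
    -- which types are stable on either side of the diagonal
    (∀ V : QuiverRep.{u}, V.IsFinite → ¬ V.IsZero → ∀ Θ : ℝ × ℝ,
      (Θ.1 < Θ.2 → (V.IsStable Θ ↔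
        (∃ (a : ℂ) (m : ℕ), 1 ≤ m ∧ V.TypeI a m) ∨ (∃ (a : ℂ) (m : ℕ), V.TypeII a m) ∨
        (∃ x : HPoint, V.TypeIII x))) ∧
      (Θ.2 < Θ.1 → (V.IsStable Θ ↔
        (∃ (a : ℂ) (m : ℕ), 1 ≤ m ∧ V.TypeIV a m) ∨ (∃ (a : ℂ) (m : ℕ), V.TypeV a m) ∨
        (∃ x : HPoint, V.TypeVI x)))) ∧
    -- each object in the list does give a finite dimensional non-zero representation
    ((∀ (a : ℂ) (m : ℕ), 1 ≤ m → ∃ V : QuiverRep.{u}, V.IsFinite ∧ ¬ V.IsZero ∧ V.TypeI a m) ∧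
      (∀ (a : ℂ) (m : ℕ), ∃ V : QuiverRep.{u}, V.IsFinite ∧ ¬ V.IsZero ∧ V.TypeII a m) ∧
      (∀ x : HPoint, ∃ V : QuiverRep.{u}, V.IsFinite ∧ ¬ V.IsZero ∧ V.TypeIII x) ∧
      (∀ (a : ℂ) (m : ℕ), 1 ≤ m → ∃ V : QuiverRep.{u}, V.IsFinite ∧ ¬ V.IsZero ∧ V.TypeIV a m) ∧
      (∀ (a : ℂ) (m : ℕ), ∃ V : QuiverRep.{u}, V.IsFinite ∧ ¬ V.IsZero ∧ V.TypeV a m) ∧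
      (∀ x : HPoint, ∃ V : QuiverRep.{u}, V.IsFinite ∧ ¬ V.IsZero ∧ V.TypeVI x)) ∧
    -- the wall that corresponds to each type
    (∀ V : QuiverRep.{u},
      (∀ (a : ℂ) (m : ℕ), 1 ≤ m → V.TypeI a m →
        V.wall ∩ {Θ | Θ.1 < Θ.2} = wallMinusMinus m ∧ (2 ≤ m → V.wall = wallMinusMinus m)) ∧
      (∀ (a : ℂ) (m : ℕ), V.TypeII a m →
        V.wall ∩ {Θ | Θ.1 < Θ.2} = wallPlusMinus m ∧ (1 ≤ m → V.wall = wallPlusMinus m)) ∧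
      (∀ x : HPoint, V.TypeIII x →
        V.wall ∩ {Θ | Θ.1 < Θ.2} = wallInfMinus ∧ (x.w = 0 → V.wall = wallInfMinus)) ∧
      (∀ (a : ℂ) (m : ℕ), 1 ≤ m → V.TypeIV a m →
        V.wall ∩ {Θ | Θ.2 < Θ.1} = wallMinusPlus m ∧ (2 ≤ m → V.wall = wallMinusPlus m)) ∧
      (∀ (a : ℂ) (m : ℕ), V.TypeV a m →
        V.wall ∩ {Θ | Θ.2 < Θ.1} = wallPlusPlus m ∧ (1 ≤ m → V.wall = wallPlusPlus m)) ∧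
      (∀ x : HPoint, V.TypeVI x →
        V.wall ∩ {Θ | Θ.2 < Θ.1} = wallInfPlus ∧ (x.w = 0 → V.wall = wallInfPlus))) ∧
    -- the walls for framed stability
    FramedRep.walls.{u} \ {((0 : ℝ), (0 : ℝ))} =
      (⋃ (m : ℕ) (_ : 1 ≤ m), wallMinusMinus m) ∪ (⋃ m : ℕ, wallPlusMinus m) ∪ wallInfMinus ∪
        (⋃ (m : ℕ) (_ : 1 ≤ m), wallMinusPlus m) ∪ (⋃ m : ℕ, wallPlusPlus m) ∪
          wallInfPlus := by
  refine ⟨fun V hf hz Θ h => ?_, fun V hf hz => ?_, fun V hf hz Θ => ⟨fun hΘ => ?_, fun hΘ => ?_⟩,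
    ⟨fun a m hm => ?_, fun a m => ?_, fun x => ?_, fun a m hm => ?_, fun a m => ?_, fun x => ?_⟩,
    fun V => ⟨fun a m hm h => ?_, fun a m h => ?_, fun x h => ?_, fun a m hm h => ?_,
      fun a m h => ?_, fun x h => ?_⟩, FramedRep.walls_diff_zero⟩
  · by_cases h11 : Module.finrank ℂ V.V₀ = 1 ∧ Module.finrank ℂ V.V₁ = 1
    · exact .inl h11
    · rcases (QuiverRep.exists_isStable_iff hf).1 ⟨Θ, h⟩ with h | h
      · exact .inr (.inl (h.a_eq_zero hf hz h11))
      · exact .inr (.inr (h.a_eq_zero hf.swap (QuiverRep.isZero_swap.not.2 hz) fun h => h11 h.symm))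
  · rw [QuiverRep.exists_isStable_iff hf, QuiverRep.negStable_iff_type hf hz,
      QuiverRep.negStable_swap_iff_type hf hz]
    simp only [or_assoc]
  · rw [QuiverRep.isStable_iff_negStable hf hΘ, QuiverRep.negStable_iff_type hf hz]
  · rw [QuiverRep.isStable_iff_negStable_swap hf hΘ, QuiverRep.negStable_swap_iff_type hf hz]
  · obtain ⟨n, rfl⟩ := Nat.exists_eq_add_of_le' hm
    simp only [typeI_iff]
    exact QuiverRep.exists_isomorphic (QuiverRep.isFinite_preprojective a n)
      (QuiverRep.not_isZero_preprojective a n)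
  · simp only [typeII_iff]
    exact QuiverRep.exists_isomorphic (QuiverRep.isFinite_preinjective a m)
      (QuiverRep.not_isZero_preinjective a m)
  · simp only [HPoint.typeIII_iff]
    exact QuiverRep.exists_isomorphic (QuiverRep.isFinite_point _ _ _)
      (QuiverRep.not_isZero_point _ _ _)
  · obtain ⟨n, rfl⟩ := Nat.exists_eq_add_of_le' hm
    simp only [typeIV_iff]
    exact QuiverRep.exists_isomorphic (QuiverRep.isFinite_preinjective a n).swap
      (QuiverRep.isZero_swap.not.2 (QuiverRep.not_isZero_preinjective a n))
  · simp only [typeV_iff]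
    exact QuiverRep.exists_isomorphic (QuiverRep.isFinite_preprojective a m).swap
      (QuiverRep.isZero_swap.not.2 (QuiverRep.not_isZero_preprojective a m))
  · simp only [HPoint.typeVI_iff]
    exact QuiverRep.exists_isomorphic (QuiverRep.isFinite_point _ _ _).swap
      (QuiverRep.isZero_swap.not.2 (QuiverRep.not_isZero_point _ _ _))
  · obtain ⟨n, rfl⟩ := Nat.exists_eq_add_of_le' hm
    rw [← (typeI_iff.1 h).wall_eq]
    exact (QuiverRep.wall_preprojective a n).imp_right fun h hn => h (by omega)
  · rw [← (typeII_iff.1 h).wall_eq]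
    exact QuiverRep.wall_preinjective a m
  · rw [← ((x.typeIII_iff).1 h).wall_eq]
    exact QuiverRep.wall_point x
  · obtain ⟨n, rfl⟩ := Nat.exists_eq_add_of_le' hm
    rw [← (typeIV_iff.1 h).wall_eq]
    exact (QuiverRep.wall_swap_model (QuiverRep.wall_preinjective a n)
      (wallMinusPlus_succ n)).imp_right fun h hn => h (by omega)
  · rw [← (typeV_iff.1 h).wall_eq]
    exact QuiverRep.wall_swap_model (QuiverRep.wall_preprojective a m) (wallPlusPlus_eq m)
  · rw [← ((x.typeVI_iff).1 h).wall_eq]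
    exact QuiverRep.wall_swap_model (QuiverRep.wall_point x) wallInfPlus_eq
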